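/- Let $k$ be a commutative ring, $R$ a (not necessarily commutative) $k$-algebra and ${}_R\mathcal M_R$ the monoidal category of $R$-$R$-bimodules over $k$ (those on which the two $k$-actions agree, i.e. left modules over $R^e=R\otimes_k R^{\mathrm{op}}$), with tensor product $\otimes_R$ and unit object $R$. Monoidal functors are strong: their structure maps $U_2\colon Ux\otimes Uy\to U(x\otimes y)$ and $U_0\colon I\to UI$ are isomorphisms. A (left) bialgebroid over $R$ is a $k$-algebra $A$ with a $k$-algebra map $s\otimes t\colon R\otimes_k R^{\mathrm{op}}\to A$, which makes $A$ an $R$-$R$-bimodule by $r\cdot a\cdot r'=s(r)t(r')a$, and a comonoid structure $(A,\Delta,\varepsilon)$ in ${}_R\mathcal M_R$ such that $\Delta$ takes values in $A\times_R A=\{X\in A\otimes_R A : X(t(r)\otimes 1)=X(1\otimes s(r))\ \forall r\in R\}$, $\Delta\colon A\to A\times_R A$ is multiplicative and unital, $\varepsilon(1_A)=1_R$, and $\varepsilon(a\,t(\varepsilon(b)))=\varepsilon(ab)=\varepsilon(a\,s(\varepsilon(b)))$ for all $a,b\in A$. The category ${}_A\mathcal M$ of left $A$-modules is then monoidal, with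 tensor product $X\otimes_R Y$ carrying the action $a(x\otimes y)=a_{(1)}x\otimes a_{(2)}y$ and with unit object $R$ carrying the action $a\cdot r=\varepsilon(a\,s(r))$, and the forgetful functor $U_A\colon{}_A\mathcal M\to{}_R\mathcal M_R$ is strict monoidal. Let $\mathcal C$ be a $k$-linear monoidal category and $U\colon\mathcal C\to{}_R\mathcal M_R$ a $k$-linear functor. The following are equivalent. (1) There are a bialgebroid $A$ over $R$ and a $k$-linear monoidal functor $K\colon\mathcal C\to{}_A\mathcal M$ that is an equivalence of categories, such that $U_A K=U$. (2) $U$ is monadic (it has a left adjoint for which the Eilenberg–Moore comparison functor is an equivalence), $U$ admits the structure of a monoidal functor, and $U$ has a right adjoint. Moreover, if $U$ is monadic and has a right adjoint, then for every given monoidal structure $(U_2,U_0)$ on $U$ the bialgebroid $A$ and the functor $K$ in (1) can be chosen such that $U_A K=U$ as monoidal functors. -/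

import Mathlib

/-!
Bimodules over a `k`-algebra `R`, their monoidal category, left bialgebroids over `R`
and the monoidal category of left modules over a left bialgebroid.
-/

open CategoryTheory MonoidalCategory
open scoped TensorProduct

universe w u v₁ u₁

noncomputable section

/-! ### Bimodules -/

section Bimodules

variable (k : Type w) [CommRing k] (R : Type u) [Ring R] [Algebra k R]

/-- The enveloping algebra `R ⊗ₖ Rᵒᵖ`. -/
abbrev EnvAlg : Type u := R ⊗[k] Rᵐᵒᵖ

/-- The category of `R`-`R`-bimodules over `k` (with central action of `k`), identified with left
modules over the enveloping algebra: `r · x · r' = (r ⊗ r') • x`. -/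
abbrev BimodCat : Type (u + 1) := ModuleCat.{u} (EnvAlg k R)

variable {R}

/-- The element `r ⊗ 1`, through which `R` acts from the left on bimodules. -/
def envL (r : R) : EnvAlg k R := r ⊗ₜ[k] 1

/-- The element `1 ⊗ r`, through which `R` acts from the right on bimodules. -/
def envR (r : R) : EnvAlg k R := 1 ⊗ₜ[k] MulOpposite.op r

variable {k}

lemma envL_mul (r r' : R) : envL k (r * r') = envL k r * envL k r' := by simp [envL]

lemma envR_mul (r r' : R) : envR k (r * r') = envR k r' * envR k r := by simp [envR]

@[simp] lemma envL_one : envL k (1 : R) = 1 := rfl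

@[simp] lemma envR_one : envR k (1 : R) = 1 := rfl

@[simp] lemma envL_zero : envL k (0 : R) = 0 := by simp [envL]

@[simp] lemma envR_zero : envR k (0 : R) = 0 := by simp [envR]

lemma envL_add (r r' : R) : envL k (r + r') = envL k r + envL k r' := by
  simp [envL, TensorProduct.add_tmul]

lemma envR_add (r r' : R) : envR k (r + r') = envR k r + envR k r' := by
  simp [envR, TensorProduct.tmul_add]

lemma envL_mul_envR (r r' : R) : envL k r * envR k r' = r ⊗ₜ[k] MulOpposite.op r' := by
  simp [envL, envR]

lemma env_comm (r r' : R) : envL k r * envR k r' = envR k r' * envL k r := by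
  simp [envL, envR]

lemma envL_algebraMap (c : k) : envL k (algebraMap k R c) = envR k (algebraMap k R c) := by
  rw [envL, envR, Algebra.algebraMap_eq_smul_one, TensorProduct.smul_tmul, MulOpposite.op_smul,
    MulOpposite.op_one]

/-- An additive map between bimodules that respects the left and the right action is a
morphism of bimodules. -/
def bimodHom {X Y : BimodCat k R} (f : X →+ Y)
    (hl : ∀ (r : R) x, f (envL k r • x) = envL k r • f x)
    (hr : ∀ (r : R) x, f (envR k r • x) = envR k r • f x) : X ⟶ Y :=
  ModuleCat.ofHom
    { toFun := f
      map_add' := f.map_add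
      map_smul' := fun e x => by
        induction e using TensorProduct.induction_on with
        | zero =>
          exact (congrArg f (zero_smul (EnvAlg k R) x)).trans
            (f.map_zero.trans (zero_smul (EnvAlg k R) (f x)).symm)
        | tmul r r' =>
          obtain ⟨r', rfl⟩ := MulOpposite.op_surjective r'
          simp [← envL_mul_envR, mul_smul, hl, hr]
        | add a b ha hb =>
          simp only [add_smul, map_add, RingHom.id_apply] at ha hb ⊢
          rw [ha, hb] }

@[simp] lemma bimodHom_apply {X Y : BimodCat k R} (f : X →+ Y) (hl) (hr) (x : X) :
    (bimodHom f hl hr).hom x = f x := rfl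

/-! ### The tensor product over `R` -/

/-- The relations `x · r ⊗ y = x ⊗ r · y`. -/
def balRel (X Y : BimodCat k R) : AddSubgroup (X ⊗[ℤ] Y) :=
  AddSubgroup.closure
    {z | ∃ (r : R) (x : X) (y : Y), z = (envR k r • x) ⊗ₜ[ℤ] y - x ⊗ₜ[ℤ] (envL k r • y)}

/-- The tensor product `X ⊗_R Y` of two bimodules. -/
def BalTensor (X Y : BimodCat k R) : Type u := (X ⊗[ℤ] Y) ⧸ balRel X Y

namespace BalTensor

instance (X Y : BimodCat k R) : AddCommGroup (BalTensor X Y) :=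
  inferInstanceAs (AddCommGroup ((X ⊗[ℤ] Y) ⧸ balRel X Y))

variable {X Y X' Y' X'' Y'' Z : BimodCat k R}

/-- The pure tensor `x ⊗ y`. -/
def tmul (x : X) (y : Y) : BalTensor X Y := QuotientAddGroup.mk (x ⊗ₜ[ℤ] y)

lemma add_tmul (x x' : X) (y : Y) : tmul (x + x') y = tmul x y + tmul x' y :=
  congrArg QuotientAddGroup.mk (TensorProduct.add_tmul x x' y)

lemma tmul_add (x : X) (y y' : Y) : tmul x (y + y') = tmul x y + tmul x y' :=
  congrArg QuotientAddGroup.mk (TensorProduct.tmul_add x y y')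

@[simp] lemma zero_tmul (y : Y) : tmul (0 : X) y = 0 :=
  congrArg QuotientAddGroup.mk (TensorProduct.zero_tmul X y)

@[simp] lemma tmul_zero (x : X) : tmul x (0 : Y) = 0 :=
  congrArg QuotientAddGroup.mk (TensorProduct.tmul_zero Y x)

lemma balanced (r : R) (x : X) (y : Y) : tmul (envR k r • x) y = tmul x (envL k r • y) := by
  refine (QuotientAddGroup.eq_iff_sub_mem).2 (AddSubgroup.subset_closure ⟨r, x, y, rfl⟩)

@[elab_as_elim]
lemma induction_on {p : BalTensor X Y → Prop} (z : BalTensor X Y) (zero : p 0)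
    (tmul : ∀ x y, p (tmul x y)) (add : ∀ a b, p a → p b → p (a + b)) : p z := by
  obtain ⟨z, rfl⟩ := QuotientAddGroup.mk_surjective z
  induction z using TensorProduct.induction_on with
  | zero => exact zero
  | tmul x y => exact tmul x y
  | add a b ha hb => exact add _ _ ha hb

/-- Biadditive balanced maps induce additive maps on the tensor product. -/
def lift {G : Type*} [AddCommGroup G] (f : X →+ Y →+ G)
    (hf : ∀ (r : R) x y, f (envR k r • x) y = f x (envL k r • y)) : BalTensor X Y →+ G :=
  QuotientAddGroup.lift (balRel X Y)
    (TensorProduct.liftAddHom f (fun n x y => by simp)) (by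
      refine (AddSubgroup.closure_le _).2 ?_
      rintro _ ⟨r, x, y, rfl⟩
      simp [AddMonoidHom.mem_ker, hf])

@[simp] lemma lift_tmul {G : Type*} [AddCommGroup G] (f : X →+ Y →+ G) (hf) (x : X) (y : Y) :
    lift f hf (tmul x y) = f x y := rfl

lemma hom_ext {G : Type*} [AddCommGroup G] {f g : BalTensor X Y →+ G}
    (h : ∀ x y, f (tmul x y) = g (tmul x y)) : f = g := by
  ext z
  induction z using induction_on with
  | zero => simp
  | tmul x y => exact h x y
  | add a b ha hb => simp [ha, hb]

/-- `tmul` as a biadditive map. -/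
def tmulHom : X →+ Y →+ BalTensor X Y :=
  AddMonoidHom.mk' (fun x => AddMonoidHom.mk' (fun y => tmul x y) (tmul_add x))
    (fun x x' => by ext y; exact add_tmul x x' y)

@[simp] lemma tmulHom_apply (x : X) (y : Y) : tmulHom x y = tmul x y := rfl

/-- The map `f ⊗ g`, for `f` compatible with the right and `g` with the left actions. -/
def mapAdd (f : X →+ X') (g : Y →+ Y') (hf : ∀ (r : R) x, f (envR k r • x) = envR k r • f x)
    (hg : ∀ (r : R) y, g (envL k r • y) = envL k r • g y) : BalTensor X Y →+ BalTensor X' Y' :=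
  lift ((tmulHom.comp f).compr₂ (AddMonoidHom.id _) |>.compl₂ g) (by
    intro r x y
    simp [hf, hg, balanced])

@[simp] lemma mapAdd_tmul (f : X →+ X') (g : Y →+ Y') (hf) (hg) (x : X) (y : Y) :
    mapAdd f g hf hg (tmul x y) = tmul (f x) (g y) := rfl

/-- Multiplication by a scalar, as an additive map. -/
def smulHom (X : BimodCat k R) (e : EnvAlg k R) : X →+ X := DistribSMul.toAddMonoidHom X e

@[simp] lemma smulHom_apply (e : EnvAlg k R) (x : X) : smulHom X e x = e • x := rfl

/-- The left action `r · (x ⊗ y) = (r · x) ⊗ y`. -/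
def lsmul (r : R) : BalTensor X Y →+ BalTensor X Y :=
  mapAdd (smulHom X (envL k r)) (AddMonoidHom.id Y)
    (fun r' x => by simp [← mul_smul, env_comm]) (fun _ _ => rfl)

/-- The right action `(x ⊗ y) · r = x ⊗ (y · r)`. -/
def rsmul (r : R) : BalTensor X Y →+ BalTensor X Y :=
  mapAdd (AddMonoidHom.id X) (smulHom Y (envR k r))
    (fun _ _ => rfl) (fun r' x => by simp [← mul_smul, env_comm])

instance : Module R (BalTensor X Y) where
  smul r z := lsmul r z
  one_smul z := by
    change lsmul 1 z = z
    refine DFunLike.congr_fun (f := lsmul 1) (g := AddMonoidHom.id _) (hom_ext fun x y => ?_) z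
    simp [lsmul]
  mul_smul r r' z := by
    change lsmul (r * r') z = lsmul r (lsmul r' z)
    refine DFunLike.congr_fun (f := lsmul (r * r')) (g := (lsmul r).comp (lsmul r'))
      (hom_ext fun x y => ?_) z
    simp [lsmul, envL_mul, mul_smul]
  smul_zero r := (lsmul r).map_zero
  smul_add r := (lsmul r).map_add
  add_smul r r' z := by
    change lsmul (r + r') z = lsmul r z + lsmul r' z
    refine DFunLike.congr_fun (f := lsmul (r + r')) (g := lsmul r + lsmul r')
      (hom_ext fun x y => ?_) z
    simp [lsmul, envL_add, add_smul, add_tmul]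
  zero_smul z := by
    change lsmul 0 z = 0
    refine DFunLike.congr_fun (f := lsmul 0) (g := 0) (hom_ext fun x y => ?_) z
    simp [lsmul, zero_smul (EnvAlg k R) x]

instance : Module Rᵐᵒᵖ (BalTensor X Y) where
  smul r z := rsmul r.unop z
  one_smul z := by
    change rsmul 1 z = z
    refine DFunLike.congr_fun (f := rsmul 1) (g := AddMonoidHom.id _) (hom_ext fun x y => ?_) z
    simp [rsmul]
  mul_smul r r' z := by
    change rsmul (r'.unop * r.unop) z = rsmul r.unop (rsmul r'.unop z)
    refine DFunLike.congr_fun (f := rsmul (r'.unop * r.unop))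
      (g := (rsmul r.unop).comp (rsmul r'.unop)) (hom_ext fun x y => ?_) z
    simp [rsmul, envR_mul, mul_smul]
  smul_zero r := (rsmul r.unop).map_zero
  smul_add r := (rsmul r.unop).map_add
  add_smul r r' z := by
    change rsmul (r.unop + r'.unop) z = rsmul r.unop z + rsmul r'.unop z
    refine DFunLike.congr_fun (f := rsmul (r.unop + r'.unop)) (g := rsmul r.unop + rsmul r'.unop)
      (hom_ext fun x y => ?_) z
    simp [rsmul, envR_add, add_smul, tmul_add]
  zero_smul z := by
    change rsmul 0 z = 0
    refine DFunLike.congr_fun (f := rsmul 0) (g := 0) (hom_ext fun x y => ?_) z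
    simp [rsmul, zero_smul (EnvAlg k R) y]

lemma smul_tmul_left (r : R) (x : X) (y : Y) : r • tmul x y = tmul (envL k r • x) y := rfl

lemma smul_tmul_right (r : Rᵐᵒᵖ) (x : X) (y : Y) :
    r • tmul x y = tmul x (envR k r.unop • y) := rfl

/-- The bimodule structure `r · (x ⊗ y) · r' = (r · x) ⊗ (y · r')`. -/
instance instModuleEnv : Module (EnvAlg k R) (BalTensor X Y) := by
  letI : Module k (BalTensor X Y) := Module.compHom _ (algebraMap k R)
  haveI : IsScalarTower k R (BalTensor X Y) := ⟨fun c r z => by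
    rw [Algebra.smul_def, mul_smul]; rfl⟩
  haveI : IsScalarTower k Rᵐᵒᵖ (BalTensor X Y) := ⟨fun c r z => by
    change (c • r) • z = algebraMap k R c • (r • z)
    induction z using induction_on with
    | zero => simp
    | tmul x y =>
      obtain ⟨r, rfl⟩ := MulOpposite.op_surjective r
      rw [smul_tmul_right, smul_tmul_right, smul_tmul_left, envL_algebraMap, balanced,
        envL_algebraMap, ← mul_smul, ← envR_mul, ← Algebra.commutes, ← Algebra.smul_def]
      rfl
    | add a b ha hb => simp only [smul_add, ha, hb]⟩
  haveI : SMulCommClass R Rᵐᵒᵖ (BalTensor X Y) := ⟨fun r r' z => by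
    induction z using induction_on with
    | zero => simp
    | tmul x y => simp only [smul_tmul_right, smul_tmul_left]
    | add a b ha hb => simp only [smul_add, ha, hb]⟩
  exact TensorProduct.Algebra.module

lemma env_smul_def (r : R) (r' : Rᵐᵒᵖ) (z : BalTensor X Y) :
    (r ⊗ₜ[k] r' : EnvAlg k R) • z = r • r' • z := by
  let : Module k (BalTensor X Y) := Module.compHom _ (algebraMap k R)
  rfl

@[simp] lemma envL_smul_tmul (r : R) (x : X) (y : Y) :
    envL k r • tmul x y = tmul (envL k r • x) y := by
  rw [envL, env_smul_def, one_smul]; rfl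

@[simp] lemma envR_smul_tmul (r : R) (x : X) (y : Y) :
    envR k r • tmul x y = tmul x (envR k r • y) := by
  rw [envR, env_smul_def, one_smul]; rfl

end BalTensor

/-! ### The monoidal category of bimodules -/

namespace BimodCat

open BalTensor

variable {X Y X' Y' X'' Y'' Z : BimodCat k R}

/-- The tensor product over `R` as a bimodule. -/
def tensor (X Y : BimodCat k R) : BimodCat k R := ModuleCat.of _ (BalTensor X Y)

/-- The pure tensor `x ⊗ y`. -/
def tm (x : X) (y : Y) : tensor X Y := tmul x y

lemma tm_add (x : X) (y y' : Y) : tm x (y + y') = tm x y + tm x y' := tmul_add x y y'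

lemma add_tm (x x' : X) (y : Y) : tm (x + x') y = tm x y + tm x' y := add_tmul x x' y

lemma tm_balanced (r : R) (x : X) (y : Y) : tm (envR k r • x) y = tm x (envL k r • y) :=
  balanced r x y

@[simp] lemma envL_smul_tm (r : R) (x : X) (y : Y) :
    envL k r • tm x y = tm (envL k r • x) y := envL_smul_tmul r x y

@[simp] lemma envR_smul_tm (r : R) (x : X) (y : Y) :
    envR k r • tm x y = tm x (envR k r • y) := envR_smul_tmul r x y

lemma tensor_hom_ext {f g : tensor X Y ⟶ Z}
    (h : ∀ x y, f.hom (tm x y) = g.hom (tm x y)) : f = g := by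
  ext z
  exact DFunLike.congr_fun (hom_ext (f := f.hom.toAddMonoidHom) (g := g.hom.toAddMonoidHom) h) z

/-- Biadditive maps compatible with the actions induce bimodule morphisms `X ⊗_R Y ⟶ Z`. -/
def tensorLift (f : X →+ Y →+ Z)
    (hf : ∀ (r : R) x y, f (envR k r • x) y = f x (envL k r • y))
    (hl : ∀ (r : R) x y, f (envL k r • x) y = envL k r • f x y)
    (hr : ∀ (r : R) x y, f x (envR k r • y) = envR k r • f x y) : tensor X Y ⟶ Z :=
  bimodHom (X := tensor X Y) (lift f hf)
    (fun r z => by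
      refine DFunLike.congr_fun (f := (lift f hf).comp (smulHom (tensor X Y) (envL k r)))
        (g := (smulHom Z (envL k r)).comp (lift f hf)) (hom_ext fun x y => ?_) z
      exact (congrArg (lift f hf) (envL_smul_tmul r x y)).trans (hl r x y))
    (fun r z => by
      refine DFunLike.congr_fun (f := (lift f hf).comp (smulHom (tensor X Y) (envR k r)))
        (g := (smulHom Z (envR k r)).comp (lift f hf)) (hom_ext fun x y => ?_) z
      exact (congrArg (lift f hf) (envR_smul_tmul r x y)).trans (hr r x y))

@[simp] lemma tensorLift_tm (f : X →+ Y →+ Z) (hf) (hl) (hr) (x : X) (y : Y) :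
    (tensorLift f hf hl hr).hom (tm x y) = f x y := rfl

/-- A biadditive map from a function of two variables. -/
def mkBi {A B C : Type*} [AddCommGroup A] [AddCommGroup B] [AddCommGroup C] (f : A → B → C)
    (h₁ : ∀ a a' b, f (a + a') b = f a b + f a' b)
    (h₂ : ∀ a b b', f a (b + b') = f a b + f a b') : A →+ B →+ C :=
  AddMonoidHom.mk' (fun a => AddMonoidHom.mk' (f a) (h₂ a)) (fun a a' => by ext b; exact h₁ a a' b)

@[simp] lemma mkBi_apply {A B C : Type*} [AddCommGroup A] [AddCommGroup B] [AddCommGroup C]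
    (f : A → B → C) (h₁) (h₂) (a : A) (b : B) : mkBi f h₁ h₂ a b = f a b := rfl

/-- The tensor product of two bimodule morphisms. -/
def map (f : X ⟶ X') (g : Y ⟶ Y') : tensor X Y ⟶ tensor X' Y' :=
  tensorLift (mkBi (fun x y => tm (f.hom x) (g.hom y))
      (fun _ _ _ => by rw [map_add, add_tm]) (fun _ _ _ => by rw [map_add, tm_add]))
    (fun r x y => by simp [tm_balanced]) (fun r x y => by simp) (fun r x y => by simp)

@[simp] lemma map_tm (f : X ⟶ X') (g : Y ⟶ Y') (x : X) (y : Y) :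
    (map f g).hom (tm x y) = tm (f.hom x) (g.hom y) := rfl

/-- Two additive maps on a triple tensor product agree if they agree on pure tensors. -/
lemma tensor_hom_ext₃ {W : BimodCat k R} {f g : tensor (tensor X Y) Z ⟶ W}
    (h : ∀ x y z, f.hom (tm (tm x y) z) = g.hom (tm (tm x y) z)) : f = g := by
  refine tensor_hom_ext fun t z => ?_
  induction t using BalTensor.induction_on with
  | zero =>
    have h0 : tm (0 : tensor X Y) z = 0 := zero_tmul z
    exact (congrArg f.hom h0).trans (((map_zero _).trans (map_zero _).symm).trans
      (congrArg g.hom h0).symm)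
  | tmul x y => exact h x y z
  | add a b ha hb =>
    have h0 := add_tm (X := tensor X Y) a b z
    refine (congrArg f.hom h0).trans (Eq.trans ?_ (congrArg g.hom h0).symm)
    rw [map_add, map_add, ha, hb]

/-- The auxiliary map `x ⊗ y ↦ (z ↦ x ⊗ (y ⊗ z))`. -/
def assocAux (X Y Z : BimodCat k R) : tensor X Y →+ Z →+ tensor X (tensor Y Z) :=
  lift (mkBi (fun x y => AddMonoidHom.mk' (fun z => tm x (tm y z))
      (fun _ _ => by rw [tm_add, tm_add]))
      (fun _ _ _ => by ext; simp [add_tm]) (fun _ _ _ => by ext; simp [tm_add, add_tm]))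
    (fun r x y => by ext; simp [tm_balanced])

@[simp] lemma assocAux_tm (x : X) (y : Y) (z : Z) :
    assocAux X Y Z (tm x y) z = tm x (tm y z) := rfl

/-- The auxiliary map `x ↦ (y ⊗ z ↦ (x ⊗ y) ⊗ z)`. -/
def assocInvAux (X Y Z : BimodCat k R) : X →+ tensor Y Z →+ tensor (tensor X Y) Z :=
  AddMonoidHom.mk' (fun x => lift (mkBi (fun y z => tm (tm x y) z)
      (fun _ _ _ => by rw [tm_add, add_tm]) (fun _ _ _ => by rw [tm_add]))
      (fun r y z => by simp [← tm_balanced]))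
    (fun x x' => hom_ext fun y z =>
      (congrArg (fun t => tm t z) (add_tm x x' y)).trans (add_tm _ _ z))

@[simp] lemma assocInvAux_tm (x : X) (y : Y) (z : Z) :
    assocInvAux X Y Z x (tm y z) = tm (tm x y) z := rfl

/-- An induction principle for the elements of a tensor product. -/
@[elab_as_elim]
lemma tensor_induction {p : tensor X Y → Prop} (z : tensor X Y) (zero : p 0)
    (tm : ∀ x y, p (tm x y)) (add : ∀ a b, p a → p b → p (a + b)) : p z :=
  BalTensor.induction_on z zero tm add

/-- The associativity isomorphism `(x ⊗ y) ⊗ z ↦ x ⊗ (y ⊗ z)`. -/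
def assoc (X Y Z : BimodCat k R) : tensor (tensor X Y) Z ≅ tensor X (tensor Y Z) where
  hom := tensorLift (assocAux X Y Z)
    (fun r t z => by
      induction t using tensor_induction with
      | zero => simp
      | tm x y => simp [tm_balanced]
      | add a b ha hb => simp only [smul_add, map_add, AddMonoidHom.add_apply, ha, hb])
    (fun r t z => by
      induction t using tensor_induction with
      | zero => simp
      | tm x y => simp
      | add a b ha hb => simp only [smul_add, map_add, AddMonoidHom.add_apply, ha, hb])
    (fun r t z => by
      induction t using tensor_induction with
      | zero => simp
      | tm x y => simp
      | add a b ha hb => simp only [smul_add, map_add, AddMonoidHom.add_apply, ha, hb])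
  inv := tensorLift (assocInvAux X Y Z)
    (fun r x t => by
      induction t using tensor_induction with
      | zero => simp
      | tm y z => simp [tm_balanced]
      | add a b ha hb => simp only [smul_add, map_add, ha, hb])
    (fun r x t => by
      induction t using tensor_induction with
      | zero => simp
      | tm y z => simp
      | add a b ha hb => simp only [smul_add, map_add, ha, hb])
    (fun r x t => by
      induction t using tensor_induction with
      | zero => simp
      | tm y z => simp
      | add a b ha hb => simp only [smul_add, map_add, ha, hb])
  hom_inv_id := tensor_hom_ext₃ fun x y z => rfl
  inv_hom_id := tensor_hom_ext fun x t => by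
    induction t using tensor_induction with
    | zero =>
      have h0 : tm x (0 : tensor Y Z) = 0 := tmul_zero x
      rw [h0, map_zero, map_zero]
    | tm y z => rfl
    | add a b ha hb => rw [tm_add, map_add, map_add, ha, hb]

@[simp] lemma assoc_hom_tm (x : X) (y : Y) (z : Z) :
    (assoc X Y Z).hom.hom (tm (tm x y) z) = tm x (tm y z) := rfl

/-- The bimodule structure `r · x · r' = r * x * r'` on `R`. -/
instance instModuleUnit : Module (EnvAlg k R) R := TensorProduct.Algebra.module

variable (k R) in
/-- The algebra `R` as a bimodule. -/
def unit : BimodCat k R := ModuleCat.of _ R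

/-- An element of `R` as an element of the bimodule `R`. -/
def toUnit (r : R) : unit k R := r

/-- An element of the bimodule `R` as an element of `R`. -/
def ofUnit (x : unit k R) : R := x

@[simp] lemma ofUnit_toUnit (r : R) : ofUnit (toUnit r : unit k R) = r := rfl

@[simp] lemma toUnit_ofUnit (x : unit k R) : toUnit (ofUnit x) = x := rfl

lemma env_smul_unit (r r' : R) (x : unit k R) :
    (r ⊗ₜ[k] MulOpposite.op r' : EnvAlg k R) • x = toUnit (r * ((ofUnit x) * r')) := rfl

lemma envL_smul_unit (r : R) (x : unit k R) :
    envL k r • x = toUnit (r * (ofUnit x)) :=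
  (env_smul_unit r 1 x).trans (by rw [mul_one])

lemma envR_smul_unit (r : R) (x : unit k R) :
    envR k r • x = toUnit ((ofUnit x) * r) :=
  (env_smul_unit 1 r x).trans (by rw [one_mul])

lemma envL_toUnit_add (r r' : unit k R) :
    envL k (ofUnit (r + r')) = envL k (ofUnit r) + envL k (ofUnit r') :=
  envL_add _ _

lemma envR_toUnit_add (r r' : unit k R) :
    envR k (ofUnit (r + r')) = envR k (ofUnit r) + envR k (ofUnit r') :=
  envR_add _ _

/-- The left unit isomorphism `r ⊗ x ↦ r · x`. -/
def leftUnit (X : BimodCat k R) : tensor (unit k R) X ≅ X where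
  hom := tensorLift (mkBi (fun r x => envL k (ofUnit r) • x)
      (fun r r' x => by rw [envL_toUnit_add, add_smul]) (fun _ _ _ => smul_add _ _ _))
    (fun r x y => by
      simp only [mkBi_apply, envR_smul_unit, ofUnit_toUnit, envL_mul, mul_smul])
    (fun r x y => by
      simp only [mkBi_apply, envL_smul_unit, ofUnit_toUnit, envL_mul, mul_smul])
    (fun r x y => by
      simp only [mkBi_apply]
      rw [← mul_smul, ← mul_smul, env_comm])
  inv := bimodHom (AddMonoidHom.mk' (fun x => tm (toUnit 1) x) (tm_add _))
    (fun r x => by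
      simp only [AddMonoidHom.mk'_apply, envL_smul_tm, ← tm_balanced]
      rw [envL_smul_unit, envR_smul_unit, ofUnit_toUnit, one_mul, mul_one])
    (fun r x => by simp)
  hom_inv_id := tensor_hom_ext fun r x => by
    change tm (toUnit 1) (envL k (ofUnit r) • x) = tm r x
    rw [← tm_balanced, envR_smul_unit]
    exact congrArg (fun s : unit k R => tm s x) (one_mul (ofUnit r))
  inv_hom_id := by
    ext x
    change envL k (1 : R) • x = x
    simp

@[simp] lemma leftUnit_hom_tm (r : unit k R) (x : X) :
    (leftUnit X).hom.hom (tm r x) = envL k (ofUnit r) • x := rfl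

/-- The right unit isomorphism `x ⊗ r ↦ x · r`. -/
def rightUnit (X : BimodCat k R) : tensor X (unit k R) ≅ X where
  hom := tensorLift (mkBi (fun x r => envR k (ofUnit r) • x)
      (fun _ _ _ => smul_add _ _ _) (fun x r r' => by rw [envR_toUnit_add, add_smul]))
    (fun r x y => by
      simp only [mkBi_apply, envL_smul_unit, ofUnit_toUnit, envR_mul, mul_smul])
    (fun r x y => by
      simp only [mkBi_apply]
      rw [← mul_smul, ← mul_smul, env_comm])
    (fun r x y => by
      simp only [mkBi_apply, envR_smul_unit, ofUnit_toUnit, envR_mul, mul_smul])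
  inv := bimodHom (AddMonoidHom.mk' (fun x => tm x (toUnit 1)) (fun _ _ => add_tm _ _ _))
    (fun r x => by simp)
    (fun r x => by
      simp only [AddMonoidHom.mk'_apply, envR_smul_tm, tm_balanced]
      rw [envL_smul_unit, envR_smul_unit, ofUnit_toUnit, one_mul, mul_one])
  hom_inv_id := tensor_hom_ext fun x r => by
    change tm (envR k (ofUnit r) • x) (toUnit 1) = tm x r
    rw [tm_balanced, envL_smul_unit]
    exact congrArg (fun s : unit k R => tm x s) (mul_one (ofUnit r))
  inv_hom_id := by
    ext x
    change envR k (1 : R) • x = x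
    simp

@[simp] lemma rightUnit_hom_tm (r : unit k R) (x : X) :
    (rightUnit X).hom.hom (tm x r) = envR k (ofUnit r) • x := rfl

/-- The monoidal category of bimodules, with tensor product `⊗_R` and unit object `R`. -/
instance instMonoidalCategory : MonoidalCategory (BimodCat k R) where
  tensorObj := tensor
  tensorHom := map
  whiskerLeft X _ _ f := map (𝟙 X) f
  whiskerRight f Y := map f (𝟙 Y)
  tensorUnit := unit k R
  associator := assoc
  leftUnitor := leftUnit
  rightUnitor := rightUnit
  tensorHom_def f g := tensor_hom_ext fun x y => rfl
  id_tensorHom_id X Y := tensor_hom_ext fun x y => rfl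
  tensorHom_comp_tensorHom f g f' g' := tensor_hom_ext fun x y => rfl
  whiskerLeft_id X Y := tensor_hom_ext fun x y => rfl
  id_whiskerRight X Y := tensor_hom_ext fun x y => rfl
  associator_naturality f g h := tensor_hom_ext₃ fun x y z => rfl
  leftUnitor_naturality f := tensor_hom_ext fun r x => (map_smul f.hom _ x).symm
  rightUnitor_naturality f := tensor_hom_ext fun x r => (map_smul f.hom _ x).symm
  pentagon W X Y Z := by
    refine tensor_hom_ext fun t z => ?_
    induction t using tensor_induction with
    | zero =>
      have h0 : tm (0 : tensor (tensor W X) Y) z = 0 := zero_tmul z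
      rw [h0, map_zero, map_zero]
    | add a b ha hb => rw [add_tm, map_add, map_add, ha, hb]
    | tm t y =>
      induction t using tensor_induction with
      | zero =>
        have h0 : tm (0 : tensor W X) y = 0 := zero_tmul y
        have h1 : tm (0 : tensor (tensor W X) Y) z = 0 := zero_tmul z
        rw [h0, h1, map_zero, map_zero]
      | add a b ha hb => rw [add_tm, add_tm, map_add, map_add, ha, hb]
      | tm w x => rfl
  triangle X Y := tensor_hom_ext₃ fun x r y => (tm_balanced _ x y).symm

end BimodCat

/-! ### Algebras over the enveloping algebra and the Takeuchi product -/

namespace Takeuchi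

open BimodCat

variable {A : Type u} [Ring A] [Algebra k A] (η : EnvAlg k R →ₐ[k] A)

/-- The source map `s : R → A`. -/
def src (r : R) : A := η (envL k r)

/-- The target map `t : Rᵒᵖ → A`. -/
def tgt (r : R) : A := η (envR k r)

/-- The forgetful functor from left `A`-modules to `R`-`R`-bimodules:
`r · x · r' = s(r) t(r') x`. -/
abbrev res : ModuleCat.{u} A ⥤ BimodCat k R := ModuleCat.restrictScalars (η : EnvAlg k R →+* A)

/-- The algebra `A` as an `R`-`R`-bimodule, `r · a · r' = s(r) t(r') a`. -/
abbrev reg : BimodCat k R := (res η).obj (ModuleCat.of A A)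

/-- An element of `A` as an element of the bimodule `A`. -/
def toReg (a : A) : reg η := a

variable {η}

/-- An element of the bimodule `A` as an element of `A`. -/
def ofReg (a : reg η) : A := a

@[simp] lemma ofReg_toReg (a : A) : ofReg (toReg η a) = a := rfl

@[simp] lemma toReg_ofReg (a : reg η) : toReg η (ofReg a) = a := rfl

lemma env_smul (M : ModuleCat.{u} A) (e : EnvAlg k R) (m : (res η).obj M) : e • m = η e • m := rfl

/-- For an `A`-module `M` and `m ∈ M`, the map `a ↦ a m`. -/
def spanHom (M : ModuleCat.{u} A) (m : (res η).obj M) : reg η ⟶ (res η).obj M :=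
  (res η).map (ModuleCat.ofHom (LinearMap.toSpanSingleton A M m))

@[simp] lemma spanHom_apply (M : ModuleCat.{u} A) (m : (res η).obj M) (a : reg η) :
    (spanHom M m).hom a = ofReg a • m := rfl

variable (η)

/-- The map `a ↦ a b`. -/
def rmulHom (b : A) : reg η ⟶ reg η := spanHom (ModuleCat.of A A) (toReg η b)

/-- The subgroup `A ×_R A` of those `X ∈ A ⊗_R A` with `X (t(r) ⊗ 1) = X (1 ⊗ s(r))` for all
`r ∈ R`. -/
def takeuchi : AddSubgroup (tensor (reg η) (reg η)) where
  carrier := {X | ∀ r : R, (map (rmulHom η (tgt η r)) (𝟙 (reg η))).hom X =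
    (map (𝟙 (reg η)) (rmulHom η (src η r))).hom X}
  zero_mem' r := by rw [map_zero, map_zero]
  add_mem' ha hb r := by rw [map_add, map_add, ha r, hb r]
  neg_mem' ha r := by rw [map_neg, map_neg, ha r]

variable {η}

lemma map_comp_apply {X Y X' Y' X'' Y'' : BimodCat k R} (f : X ⟶ X') (f' : X' ⟶ X'')
    (g : Y ⟶ Y') (g' : Y' ⟶ Y'') (z : tensor X Y) :
    (map f' g').hom ((map f g).hom z) = (map (f ≫ f') (g ≫ g')).hom z := by
  have : map f g ≫ map f' g' = map (f ≫ f') (g ≫ g') := tensor_hom_ext fun x y => rfl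
  rw [← this]; rfl

lemma map_add_left {X Y X' Y' : BimodCat k R} (f f' : X ⟶ X') (g : Y ⟶ Y') (z : tensor X Y) :
    (map (f + f') g).hom z = (map f g).hom z + (map f' g).hom z := by
  have : map (f + f') g = map f g + map f' g := tensor_hom_ext fun x y => add_tm _ _ _
  rw [this]; rfl

lemma map_add_right {X Y X' Y' : BimodCat k R} (f : X ⟶ X') (g g' : Y ⟶ Y') (z : tensor X Y) :
    (map f (g + g')).hom z = (map f g).hom z + (map f g').hom z := by
  have : map f (g + g') = map f g + map f g' := tensor_hom_ext fun x y => tm_add _ _ _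
  rw [this]; rfl

lemma spanHom_add (M : ModuleCat.{u} A) (m m' : (res η).obj M) :
    spanHom M (m + m') = spanHom M m + spanHom M m' := by
  ext a; exact smul_add (ofReg a) m m'

lemma spanHom_smul (M : ModuleCat.{u} A) (b : A) (m : (res η).obj M) :
    spanHom M (b • m) = rmulHom η b ≫ spanHom M m := by
  ext a; exact (mul_smul (ofReg a) b m).symm

lemma spanHom_one : spanHom (ModuleCat.of A A) (toReg η 1) = 𝟙 (reg η) := by
  ext a; exact mul_one (ofReg a)

lemma spanHom_comp (M : ModuleCat.{u} A) (b : reg η) (m : (res η).obj M) :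
    spanHom (ModuleCat.of A A) b ≫ spanHom M m = spanHom M (ofReg b • m) := by
  ext a; exact mul_smul (ofReg a) (ofReg b) m

lemma spanHom_map {M N : ModuleCat.{u} A} (f : M ⟶ N) (m : (res η).obj M) :
    spanHom M m ≫ (res η).map f = spanHom N (((res η).map f).hom m) := by
  ext a; exact f.hom.map_smul (ofReg a) m

/-- The action of `X = ∑ aᵢ ⊗ bᵢ ∈ A ×_R A` on the tensor product of the bimodules underlying two
`A`-modules: `X (m ⊗ n) = ∑ aᵢ m ⊗ bᵢ n`. For `M = N = A` and a second element of `A ×_R A` this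
is the multiplication of `A ×_R A`. -/
def act (M N : ModuleCat.{u} A) (X : takeuchi η) :
    tensor ((res η).obj M) ((res η).obj N) →+ tensor ((res η).obj M) ((res η).obj N) :=
  BalTensor.lift (mkBi (fun m n => (map (spanHom M m) (spanHom N n)).hom X.1)
      (fun m m' n => by rw [spanHom_add, map_add_left])
      (fun m n n' => by rw [spanHom_add, map_add_right]))
    (fun r m n => by
      have h := congrArg (map (spanHom M m) (spanHom N n)).hom (X.2 r)
      rw [map_comp_apply, map_comp_apply, Category.id_comp, Category.id_comp] at h
      simp only [mkBi_apply]
      rw [env_smul, env_smul, spanHom_smul, spanHom_smul]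
      exact h)

@[simp] lemma act_tm (M N : ModuleCat.{u} A) (X : takeuchi η) (m : (res η).obj M)
    (n : (res η).obj N) :
    act M N X (tm m n) = (map (spanHom M m) (spanHom N n)).hom X.1 := rfl

/-- The product `(∑ aᵢ ⊗ bᵢ) (∑ cⱼ ⊗ dⱼ) = ∑ aᵢ cⱼ ⊗ bᵢ dⱼ` of elements of `A ×_R A`. -/
def mulT (X Y : takeuchi η) : tensor (reg η) (reg η) :=
  act (ModuleCat.of A A) (ModuleCat.of A A) X Y.1

lemma act_mulT (M N : ModuleCat.{u} A) (X Y Z : takeuchi η) (h : Z.1 = mulT X Y)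
    (z : tensor ((res η).obj M) ((res η).obj N)) :
    act M N Z z = act M N X (act M N Y z) := by
  induction z using tensor_induction with
  | zero => simp only [map_zero]
  | add a b ha hb => simp only [map_add, ha, hb]
  | tm m n =>
    rw [act_tm, act_tm, h, mulT]
    generalize Y.1 = y
    induction y using tensor_induction with
    | zero => simp only [map_zero]
    | add a b ha hb => simp only [map_add, ha, hb]
    | tm c d =>
      rw [act_tm, map_comp_apply, spanHom_comp, spanHom_comp]
      rfl

end Takeuchi

end Bimodules

/-! ### Bialgebroids -/

section Bialgebroids

variable (k : Type w) [CommRing k] (R : Type u) [Ring R] [Algebra k R]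

open Takeuchi BimodCat

/-- A left bialgebroid (Takeuchi `×_R`-bialgebra) over `R`. -/
structure Bialgebroid where
  /-- The total algebra `A`. -/
  carrier : Type u
  [ring : Ring carrier]
  [algebra : Algebra k carrier]
  /-- The algebra map `s ⊗ t : R ⊗ₖ Rᵒᵖ → A`. -/
  st : EnvAlg k R →ₐ[k] carrier
  /-- The comonoid structure on the bimodule `A`. -/
  [comon : ComonObj (reg st)]
  comul_mem : ∀ a : carrier, (ComonObj.comul (X := reg st)).hom (toReg st a) ∈ takeuchi st
  comul_one : (ComonObj.comul (X := reg st)).hom (toReg st 1) = tm (toReg st 1) (toReg st 1)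
  comul_mul : ∀ a b : carrier, (ComonObj.comul (X := reg st)).hom (toReg st (a * b)) =
    mulT ⟨_, comul_mem a⟩ ⟨_, comul_mem b⟩
  counit_one : ofUnit ((ComonObj.counit (X := reg st)).hom (toReg st 1)) = 1
  counit_mul_tgt : ∀ a b : carrier,
    (ComonObj.counit (X := reg st)).hom
      (toReg st (a * tgt st (ofUnit ((ComonObj.counit (X := reg st)).hom (toReg st b))))) =
    (ComonObj.counit (X := reg st)).hom (toReg st (a * b))
  counit_mul_src : ∀ a b : carrier,
    (ComonObj.counit (X := reg st)).hom
      (toReg st (a * src st (ofUnit ((ComonObj.counit (X := reg st)).hom (toReg st b))))) =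
    (ComonObj.counit (X := reg st)).hom (toReg st (a * b))

attribute [instance] Bialgebroid.ring Bialgebroid.algebra Bialgebroid.comon

variable {k R}

namespace Bialgebroid

variable (B : Bialgebroid k R)

/-- The category of left modules over a bialgebroid. -/
abbrev Mod : Type (u + 1) := ModuleCat.{u} B.carrier

/-- The forgetful functor `U_A` from `A`-modules to `R`-`R`-bimodules. -/
abbrev forget : B.Mod ⥤ BimodCat k R := res B.st

/-- The comultiplication `A → A ×_R A`. -/
def comul (a : B.carrier) : takeuchi B.st :=
  ⟨(ComonObj.comul (X := reg B.st)).hom (toReg B.st a), B.comul_mem a⟩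

/-- The counit `A → R`. -/
def counit (a : B.carrier) : R :=
  ofUnit ((ComonObj.counit (X := reg B.st)).hom (toReg B.st a))

lemma counit_add (a b : B.carrier) : B.counit (a + b) = B.counit a + B.counit b :=
  (ComonObj.counit (X := reg B.st)).hom.map_add _ _

lemma counit_zero : B.counit 0 = 0 :=
  (ComonObj.counit (X := reg B.st)).hom.map_zero

lemma counit_st_mul (e : EnvAlg k R) (a : B.carrier) :
    toUnit (k := k) (B.counit (B.st e * a)) = e • toUnit (k := k) (B.counit a) :=
  (ComonObj.counit (X := reg B.st)).hom.map_smul e (toReg B.st a)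

lemma counit_src_mul (r : R) (a : B.carrier) :
    B.counit (src B.st r * a) = r * B.counit a :=
  (B.counit_st_mul (envL k r) a).trans (envL_smul_unit r _)

lemma counit_one' : B.counit 1 = 1 := B.counit_one

lemma counit_src (r : R) : B.counit (src B.st r) = r := by
  have := B.counit_src_mul r 1
  rwa [mul_one, counit_one', mul_one] at this

lemma counit_mul_tgt' (a : B.carrier) (r : R) :
    B.counit (a * tgt B.st r) = B.counit (a * src B.st r) := by
  have := B.counit_mul_tgt a (src B.st r)
  have h : B.counit (a * tgt B.st (B.counit (src B.st r))) = B.counit (a * src B.st r) := this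
  rwa [counit_src] at h

lemma counit_mul_src' (a b : B.carrier) :
    B.counit (a * src B.st (B.counit b)) = B.counit (a * b) := B.counit_mul_src a b

lemma comul_st (e : EnvAlg k R) :
    (B.comul (B.st e)).1 = e • tm (toReg B.st 1) (toReg B.st 1) := by
  rw [← B.comul_one, ← (ComonObj.comul (X := reg B.st)).hom.map_smul]
  exact congrArg (ComonObj.comul (X := reg B.st)).hom (mul_one (B.st e)).symm

lemma comul_mul_src (a : B.carrier) (r : R) :
    (B.comul (a * src B.st r)).1 =
      (map (rmulHom B.st (src B.st r)) (𝟙 (reg B.st))).hom (B.comul a).1 := by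
  refine (B.comul_mul a (src B.st r)).trans ?_
  change act _ _ (B.comul a) (B.comul (B.st (envL k r))).1 = _
  rw [comul_st, envL_smul_tm, act_tm, spanHom_one]
  have h : envL k r • toReg B.st (1 : B.carrier) = toReg B.st (src B.st r) :=
    mul_one (src B.st r)
  rw [h]
  rfl

lemma comul_mul_tgt (a : B.carrier) (r : R) :
    (B.comul (a * tgt B.st r)).1 =
      (map (𝟙 (reg B.st)) (rmulHom B.st (tgt B.st r))).hom (B.comul a).1 := by
  refine (B.comul_mul a (tgt B.st r)).trans ?_
  change act _ _ (B.comul a) (B.comul (B.st (envR k r))).1 = _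
  rw [comul_st, envR_smul_tm, act_tm, spanHom_one]
  have h : envR k r • toReg B.st (1 : B.carrier) = toReg B.st (tgt B.st r) :=
    mul_one (tgt B.st r)
  rw [h]
  rfl

/-- The `A`-action `a (x ⊗ y) = ∑ a₁ x ⊗ a₂ y` on the tensor product over `R`. -/
@[reducible] def moduleTensor (M N : B.Mod) :
    Module B.carrier (tensor (B.forget.obj M) (B.forget.obj N)) where
  smul a z := act M N (B.comul a) z
  one_smul z := by
    change act M N (B.comul 1) z = z
    induction z using tensor_induction with
    | zero => rw [map_zero]
    | add a b ha hb => rw [map_add, ha, hb]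
    | tm m n =>
      refine (congrArg (map (spanHom M m) (spanHom N n)).hom B.comul_one).trans ?_
      exact congrArg₂ tm (one_smul B.carrier m) (one_smul B.carrier n)
  mul_smul a b z := act_mulT M N (B.comul a) (B.comul b) (B.comul (a * b)) (B.comul_mul a b) z
  smul_zero a := map_zero _
  smul_add a := map_add _
  add_smul a b z := by
    change act M N (B.comul (a + b)) z = act M N (B.comul a) z + act M N (B.comul b) z
    have h : (B.comul (a + b)).1 = (B.comul a).1 + (B.comul b).1 :=
      (ComonObj.comul (X := reg B.st)).hom.map_add _ _
    induction z using tensor_induction with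
    | zero => simp only [map_zero, add_zero]
    | add x y hx hy => simp only [map_add, hx, hy]; abel
    | tm m n => rw [act_tm, act_tm, act_tm, h, map_add]
  zero_smul z := by
    change act M N (B.comul 0) z = 0
    have h : (B.comul 0).1 = 0 := (ComonObj.comul (X := reg B.st)).hom.map_zero
    induction z using tensor_induction with
    | zero => rw [map_zero]
    | add x y hx hy => rw [map_add, hx, hy, add_zero]
    | tm m n => rw [act_tm, h, map_zero]

/-- The tensor product of two `A`-modules. -/
def tensorMod (M N : B.Mod) : B.Mod :=
  letI := B.moduleTensor M N
  ModuleCat.of B.carrier (tensor (B.forget.obj M) (B.forget.obj N))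

lemma smul_tensorMod (M N : B.Mod) (a : B.carrier) (z : tensorMod B M N) :
    a • z = act M N (B.comul a) z := rfl

/-- The bimodule underlying the tensor product of two `A`-modules is the tensor product of the
underlying bimodules (the isomorphism is the identity map). -/
def forgetTensor (M N : B.Mod) :
    tensor (B.forget.obj M) (B.forget.obj N) ≅ B.forget.obj (B.tensorMod M N) := by
  have key : ∀ (e : EnvAlg k R) (z : tensor (B.forget.obj M) (B.forget.obj N)),
      e • z = act M N (B.comul (B.st e)) z := by
    intro e z
    have h := B.comul_st e
    induction z using tensor_induction with
    | zero => rw [smul_zero, map_zero]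
    | add x y hx hy => rw [smul_add, map_add, hx, hy]
    | tm m n =>
      rw [act_tm, h, map_smul]
      exact congrArg (e • ·)
        (congrArg₂ tm (one_smul B.carrier m).symm (one_smul B.carrier n).symm)
  exact
    { hom := ModuleCat.ofHom (X := tensor (B.forget.obj M) (B.forget.obj N))
          (Y := B.forget.obj (B.tensorMod M N))
        { toFun := fun z => z, map_add' := fun _ _ => rfl, map_smul' := key }
      inv := ModuleCat.ofHom (X := B.forget.obj (B.tensorMod M N))
          (Y := tensor (B.forget.obj M) (B.forget.obj N))
        { toFun := fun z => z, map_add' := fun _ _ => rfl, map_smul' := fun e z => (key e z).symm }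
      hom_inv_id := rfl
      inv_hom_id := rfl }

/-- The `A`-action `a · r = ε(a s(r))` on `R`. -/
@[reducible] def moduleUnit : Module B.carrier (unit k R) where
  smul a r := toUnit (B.counit (a * src B.st (ofUnit r)))
  one_smul r := congrArg toUnit ((congrArg B.counit (one_mul _)).trans (B.counit_src (ofUnit r)))
  mul_smul a b r := by
    change toUnit (B.counit (a * b * src B.st (ofUnit r))) =
      toUnit (B.counit (a * src B.st (B.counit (b * src B.st (ofUnit r)))))
    rw [counit_mul_src', mul_assoc]
  smul_zero a := by
    change toUnit (B.counit (a * src B.st 0)) = toUnit 0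
    rw [src, envL_zero, map_zero, mul_zero, counit_zero]
  smul_add a r r' := by
    change toUnit (B.counit (a * src B.st (ofUnit r + ofUnit r'))) =
      toUnit (B.counit (a * src B.st (ofUnit r)) + B.counit (a * src B.st (ofUnit r')))
    rw [src, envL_add, map_add, mul_add, counit_add]; rfl
  add_smul a b r := by
    change toUnit (B.counit ((a + b) * src B.st (ofUnit r))) =
      toUnit (B.counit (a * src B.st (ofUnit r)) + B.counit (b * src B.st (ofUnit r)))
    rw [add_mul, counit_add]
  zero_smul r := by
    change toUnit (B.counit (0 * src B.st (ofUnit r))) = toUnit 0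
    rw [zero_mul, counit_zero]

/-- The unit object `R` of the category of `A`-modules. -/
def unitMod : B.Mod :=
  letI := B.moduleUnit
  ModuleCat.of B.carrier (unit k R)

/-- The bimodule underlying the unit `A`-module is `R` (the isomorphism is the identity map). -/
def forgetUnit : unit k R ≅ B.forget.obj B.unitMod := by
  have key : ∀ (e : EnvAlg k R) (z : unit k R),
      e • z = toUnit (B.counit (B.st e * src B.st (ofUnit z))) := by
    intro e z
    rw [counit_st_mul, counit_src, toUnit_ofUnit]
  exact
    { hom := ModuleCat.ofHom (X := unit k R) (Y := B.forget.obj B.unitMod)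
        { toFun := fun z => z, map_add' := fun _ _ => rfl, map_smul' := key }
      inv := ModuleCat.ofHom (X := B.forget.obj B.unitMod) (Y := unit k R)
        { toFun := fun z => z, map_add' := fun _ _ => rfl, map_smul' := fun e z => (key e z).symm }
      hom_inv_id := rfl
      inv_hom_id := rfl }

/-- A morphism of the underlying bimodules that is `A`-linear is a morphism of `A`-modules. -/
def liftHom {M N : B.Mod} (f : B.forget.obj M ⟶ B.forget.obj N)
    (h : ∀ (a : B.carrier) (x : B.forget.obj M), f.hom (a • x) = a • f.hom x) : M ⟶ N :=
  ModuleCat.ofHom { toFun := fun x => f.hom x, map_add' := f.hom.map_add, map_smul' := h }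

@[simp] lemma forget_liftHom {M N : B.Mod} (f : B.forget.obj M ⟶ B.forget.obj N) (h) :
    B.forget.map (B.liftHom f h) = f := rfl

/-- An isomorphism of the underlying bimodules that is `A`-linear is an isomorphism of
`A`-modules. -/
def liftIso {M N : B.Mod} (f : B.forget.obj M ≅ B.forget.obj N)
    (h : ∀ (a : B.carrier) (x : B.forget.obj M), f.hom.hom (a • x) = a • f.hom.hom x) :
    M ≅ N where
  hom := B.liftHom f.hom h
  inv := B.liftHom f.inv (fun a x => by
    have h1 : ∀ y, f.hom.hom (f.inv.hom y) = y := fun y =>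
      congrArg (fun g : B.forget.obj N ⟶ B.forget.obj N => g.hom y) f.inv_hom_id
    have h2 : ∀ y, f.inv.hom (f.hom.hom y) = y := fun y =>
      congrArg (fun g : B.forget.obj M ⟶ B.forget.obj M => g.hom y) f.hom_inv_id
    have := h a (f.inv.hom x)
    rw [h1] at this
    rw [← this, h2])
  hom_inv_id := B.forget.map_injective (by
    rw [Functor.map_comp, forget_liftHom, forget_liftHom, f.hom_inv_id, CategoryTheory.Functor.map_id])
  inv_hom_id := B.forget.map_injective (by
    rw [Functor.map_comp, forget_liftHom, forget_liftHom, f.inv_hom_id, CategoryTheory.Functor.map_id])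

/-- The tensor product of two `A`-linear maps. -/
def mapMod {M M' N N' : B.Mod} (f : M ⟶ M') (g : N ⟶ N') :
    B.tensorMod M N ⟶ B.tensorMod M' N' :=
  B.liftHom ((B.forgetTensor M N).inv ≫ map (B.forget.map f) (B.forget.map g) ≫
    (B.forgetTensor M' N').hom) (fun a (z : tensor (B.forget.obj M) (B.forget.obj N)) => by
      change (map (B.forget.map f) (B.forget.map g)).hom (act M N (B.comul a) z) =
        act M' N' (B.comul a) ((map (B.forget.map f) (B.forget.map g)).hom z)
      induction z using tensor_induction with
      | zero => simp only [map_zero]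
      | add x y hx hy => simp only [map_add, hx, hy]
      | tm m n => rw [act_tm, map_comp_apply, map_tm, act_tm, spanHom_map, spanHom_map])

lemma spanHom_tm (M N : B.Mod) (m : B.forget.obj M) (n : B.forget.obj N) :
    spanHom (B.tensorMod M N) ((B.forgetTensor M N).hom.hom (tm m n)) ≫ (B.forgetTensor M N).inv =
      ComonObj.comul (X := reg B.st) ≫ map (spanHom M m) (spanHom N n) := rfl

lemma linear_of_tm {M N Q : B.Mod} (f : B.forget.obj (B.tensorMod M N) ⟶ B.forget.obj Q)
    (h : ∀ (a : B.carrier) (m : B.forget.obj M) (n : B.forget.obj N),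
      ((B.forgetTensor M N).hom ≫ f).hom ((map (spanHom M m) (spanHom N n)).hom (B.comul a).1) =
        a • ((B.forgetTensor M N).hom ≫ f).hom (tm m n))
    (a : B.carrier) (z : B.forget.obj (B.tensorMod M N)) : f.hom (a • z) = a • f.hom z := by
  change ((B.forgetTensor M N).hom ≫ f).hom (act M N (B.comul a) z) =
    a • ((B.forgetTensor M N).hom ≫ f).hom z
  generalize (B.forgetTensor M N).hom ≫ f = g at h
  change tensor (B.forget.obj M) (B.forget.obj N) at z
  induction z using tensor_induction with
  | zero => rw [map_zero, map_zero, smul_zero]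
  | add x y hx hy => rw [map_add, map_add, map_add, smul_add, hx, hy]
  | tm m n => exact h a m n

lemma linear_of_tm₃ {M N P Q : B.Mod}
    (f : B.forget.obj (B.tensorMod (B.tensorMod M N) P) ⟶ B.forget.obj Q)
    (h : ∀ (a : B.carrier) (m : B.forget.obj M) (n : B.forget.obj N) (p : B.forget.obj P),
      ((B.forgetTensor _ _).hom ≫ f).hom ((map
        (spanHom (B.tensorMod M N) ((B.forgetTensor M N).hom.hom (tm m n)))
        (spanHom P p)).hom (B.comul a).1) =
        a • ((B.forgetTensor _ _).hom ≫ f).hom (tm ((B.forgetTensor M N).hom.hom (tm m n)) p))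
    (a : B.carrier) (z : B.forget.obj (B.tensorMod (B.tensorMod M N) P)) :
    f.hom (a • z) = a • f.hom z := by
  refine B.linear_of_tm f (fun a t p => ?_) a z
  generalize (B.forgetTensor _ _).hom ≫ f = g at h
  obtain ⟨t, rfl⟩ : ∃ t', (B.forgetTensor M N).hom.hom t' = t := ⟨t, rfl⟩
  induction t using tensor_induction with
  | zero =>
    have h0 : tm (0 : B.forget.obj (B.tensorMod M N)) p = 0 := BalTensor.zero_tmul p
    have h1 : spanHom (η := B.st) (B.tensorMod M N) 0 = 0 := by
      ext c; exact smul_zero (ofReg c)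
    have h2 : map (0 : reg B.st ⟶ B.forget.obj (B.tensorMod M N)) (spanHom P p) = 0 :=
      tensor_hom_ext fun x y => BalTensor.zero_tmul _
    rw [map_zero, h0, h1, h2, map_zero, smul_zero]
    exact map_zero g.hom
  | add x y hx hy =>
    rw [map_add, spanHom_add, map_add_left, map_add, hx, hy, ← smul_add, ← map_add, ← add_tm]
  | tm m n => exact h a m n p

lemma assoc_natural {X Y Z X' Y' Z' : BimodCat k R} (f : X ⟶ X') (g : Y ⟶ Y') (h : Z ⟶ Z')
    (t : tensor (tensor X Y) Z) :
    (assoc X' Y' Z').hom.hom ((map (map f g) h).hom t) =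
      (map f (map g h)).hom ((assoc X Y Z).hom.hom t) := by
  have : map (map f g) h ≫ (assoc X' Y' Z').hom = (assoc X Y Z).hom ≫ map f (map g h) :=
    tensor_hom_ext₃ fun x y z => rfl
  exact congrArg (fun φ => φ.hom t) this

/-- Coassociativity, for elements. -/
lemma comul_assoc' (x : reg B.st) :
    (assoc _ _ _).hom.hom ((map (ComonObj.comul (X := reg B.st)) (𝟙 _)).hom
      ((ComonObj.comul (X := reg B.st)).hom x)) =
    (map (𝟙 _) (ComonObj.comul (X := reg B.st))).hom
      ((ComonObj.comul (X := reg B.st)).hom x) :=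
  (congrArg (fun f => f.hom x) (ComonObj.comul_assoc (reg B.st))).symm

/-- The associativity isomorphism of the underlying bimodules. -/
def assocForget (M N P : B.Mod) :
    B.forget.obj (B.tensorMod (B.tensorMod M N) P) ≅
      B.forget.obj (B.tensorMod M (B.tensorMod N P)) :=
  ((B.forgetTensor _ _).symm ≪≫ ((B.forgetTensor _ _).symm ⊗ᵢ .refl _)) ≪≫
    α_ (B.forget.obj M) (B.forget.obj N) (B.forget.obj P) ≪≫
    ((.refl _ ⊗ᵢ B.forgetTensor _ _) ≪≫ B.forgetTensor _ _)

lemma assocForget_apply (M N P : B.Mod)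
    (t : tensor (B.forget.obj (B.tensorMod M N)) (B.forget.obj P)) :
    ((B.forgetTensor _ _).hom ≫ (B.assocForget M N P).hom).hom t =
      (B.forgetTensor M (B.tensorMod N P)).hom.hom
        ((map (𝟙 (B.forget.obj M)) (B.forgetTensor N P).hom).hom
        ((assoc (B.forget.obj M) (B.forget.obj N) (B.forget.obj P)).hom.hom
        ((map (B.forgetTensor M N).inv (𝟙 (B.forget.obj P))).hom t))) := rfl

/-- The associativity isomorphism of `A`-modules, `(x ⊗ y) ⊗ z ↦ x ⊗ (y ⊗ z)`. -/
def assocMod (M N P : B.Mod) :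
    B.tensorMod (B.tensorMod M N) P ≅ B.tensorMod M (B.tensorMod N P) :=
  B.liftIso (B.assocForget M N P) (B.linear_of_tm₃ _ (fun a m n p => by
      rw [assocForget_apply, assocForget_apply, map_comp_apply, spanHom_tm, Category.comp_id]
      have h := congrArg (map (spanHom M m) (map (spanHom N n) (spanHom P p))).hom
        (B.comul_assoc' (toReg B.st a))
      rw [map_comp_apply, Category.id_comp, ← assoc_natural, map_comp_apply,
        Category.id_comp] at h
      have h' := congrArg (map (𝟙 (B.forget.obj M)) (B.forgetTensor N P).hom).hom h
      rw [map_comp_apply, Category.assoc, Category.comp_id] at h'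
      exact h'))

lemma counit_comul' (x : reg B.st) :
    (leftUnit _).hom.hom ((map (ComonObj.counit (X := reg B.st)) (𝟙 _)).hom
      ((ComonObj.comul (X := reg B.st)).hom x)) = x := by
  have h := (Iso.eq_comp_inv _).1 ((ComonObj.counit_comul (reg B.st)).trans
    (Category.id_comp _).symm)
  exact congrArg (fun f => f.hom x) ((Category.assoc _ _ _).symm.trans h)

lemma comul_counit' (x : reg B.st) :
    (rightUnit _).hom.hom ((map (𝟙 _) (ComonObj.counit (X := reg B.st))).hom
      ((ComonObj.comul (X := reg B.st)).hom x)) = x := by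
  have h := (Iso.eq_comp_inv _).1 ((ComonObj.comul_counit (reg B.st)).trans
    (Category.id_comp _).symm)
  exact congrArg (fun f => f.hom x) ((Category.assoc _ _ _).symm.trans h)

lemma spanHom_unit_src (r : unit k R) :
    spanHom B.unitMod (B.forgetUnit.hom.hom r) ≫ B.forgetUnit.inv =
      rmulHom B.st (src B.st (ofUnit r)) ≫ ComonObj.counit (X := reg B.st) := rfl

lemma spanHom_unit_tgt (r : unit k R) :
    spanHom B.unitMod (B.forgetUnit.hom.hom r) ≫ B.forgetUnit.inv =
      rmulHom B.st (tgt B.st (ofUnit r)) ≫ ComonObj.counit (X := reg B.st) := by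
  ext a
  exact congrArg (toUnit (k := k) (R := R)) (B.counit_mul_tgt' (ofReg a) (ofUnit r)).symm

lemma leftUnit_natural {X Y : BimodCat k R} (f : X ⟶ Y) (t : tensor (unit k R) X) :
    (leftUnit Y).hom.hom ((map (𝟙 _) f).hom t) = f.hom ((leftUnit X).hom.hom t) :=
  congrArg (fun φ => φ.hom t) (leftUnitor_naturality f)

lemma rightUnit_natural {X Y : BimodCat k R} (f : X ⟶ Y) (t : tensor X (unit k R)) :
    (rightUnit Y).hom.hom ((map f (𝟙 _)).hom t) = f.hom ((rightUnit X).hom.hom t) :=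
  congrArg (fun φ => φ.hom t) (rightUnitor_naturality f)

/-- The left unit isomorphism of `A`-modules. -/
def leftUnitMod (M : B.Mod) : B.tensorMod B.unitMod M ≅ M :=
  B.liftIso (((B.forgetTensor _ _).symm ≪≫ (B.forgetUnit.symm ⊗ᵢ .refl _)) ≪≫
      λ_ (B.forget.obj M)) (B.linear_of_tm _ (fun a r m => by
    obtain ⟨r, rfl⟩ : ∃ r', B.forgetUnit.hom.hom r' = r := ⟨r, rfl⟩
    change (leftUnit _).hom.hom ((map B.forgetUnit.inv (𝟙 _)).hom
      ((map (spanHom B.unitMod (B.forgetUnit.hom.hom r)) (spanHom M m)).hom (B.comul a).1)) =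
        a • (src B.st (ofUnit r) • m)
    have h := congrArg (spanHom M m).hom
      (B.counit_comul' (toReg B.st (a * src B.st (ofUnit r))))
    rw [← leftUnit_natural, map_comp_apply, Category.id_comp, Category.comp_id] at h
    refine Eq.trans ?_ (h.trans (mul_smul a (src B.st (ofUnit r)) m))
    rw [map_comp_apply, spanHom_unit_src, Category.comp_id]
    have h2 := congrArg (map (ComonObj.counit (X := reg B.st)) (spanHom M m)).hom
      (B.comul_mul_src a (ofUnit r))
    rw [map_comp_apply, Category.id_comp] at h2
    exact congrArg (leftUnit _).hom.hom h2.symm))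

/-- The right unit isomorphism of `A`-modules. -/
def rightUnitMod (M : B.Mod) : B.tensorMod M B.unitMod ≅ M :=
  B.liftIso (((B.forgetTensor _ _).symm ≪≫ (.refl _ ⊗ᵢ B.forgetUnit.symm)) ≪≫
      ρ_ (B.forget.obj M)) (B.linear_of_tm _ (fun a m r => by
    obtain ⟨r, rfl⟩ : ∃ r', B.forgetUnit.hom.hom r' = r := ⟨r, rfl⟩
    change (rightUnit _).hom.hom ((map (𝟙 _) B.forgetUnit.inv).hom
      ((map (spanHom M m) (spanHom B.unitMod (B.forgetUnit.hom.hom r))).hom (B.comul a).1)) =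
        a • (tgt B.st (ofUnit r) • m)
    have h := congrArg (spanHom M m).hom
      (B.comul_counit' (toReg B.st (a * tgt B.st (ofUnit r))))
    rw [← rightUnit_natural, map_comp_apply, Category.id_comp, Category.comp_id] at h
    refine Eq.trans ?_ (h.trans (mul_smul a (tgt B.st (ofUnit r)) m))
    rw [map_comp_apply, spanHom_unit_tgt, Category.comp_id]
    have h2 := congrArg (map (spanHom M m) (ComonObj.counit (X := reg B.st))).hom
      (B.comul_mul_tgt a (ofUnit r))
    rw [map_comp_apply, Category.id_comp] at h2
    exact congrArg (rightUnit _).hom.hom h2.symm))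

instance instMonoidalCategoryStruct : MonoidalCategoryStruct B.Mod where
  tensorObj := B.tensorMod
  tensorHom := B.mapMod
  whiskerLeft M _ _ f := B.mapMod (𝟙 M) f
  whiskerRight f M := B.mapMod f (𝟙 M)
  tensorUnit := B.unitMod
  associator := B.assocMod
  leftUnitor := B.leftUnitMod
  rightUnitor := B.rightUnitMod

/-- The forgetful functor preserves the monoidal data strictly: the structure isomorphisms are
identity maps. -/
def forgetData : Monoidal.InducingFunctorData B.forget where
  μIso := B.forgetTensor
  εIso := B.forgetUnit
  whiskerLeft_eq _ _ _ _ := rfl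
  whiskerRight_eq _ _ := rfl
  tensorHom_eq _ _ := rfl
  associator_eq _ _ _ := rfl
  leftUnitor_eq _ := rfl
  rightUnitor_eq _ := rfl

/-- The monoidal category of left modules over a bialgebroid. -/
instance instMonoidalCategory : MonoidalCategory B.Mod := Monoidal.induced B.forget B.forgetData

/-- The strict monoidal structure of the forgetful functor `U_A`. -/
instance instForgetMonoidal : B.forget.Monoidal := Monoidal.fromInducedMonoidal B.forget B.forgetData

end Bialgebroid

end Bialgebroids

end

/- The `k`-linear structure on the hom-groups of categories of modules over a `k`-algebra. -/
open scoped ModuleCat.Algebra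

/-!
Over a ring `E`, a functor `U : C ⥤ Mod E` with a left adjoint `L` has an object `P = L E` that
represents it: morphisms `P ⟶ X` correspond to elements of `U X`. So `A = U P`, the opposite of the
endomorphism ring of `P`, acts on every `U X`, and `U` lifts to a functor `K : C ⥤ Mod A`
(`FreeGen.lift`) whose composite with restriction of scalars is strictly `U`
(`FreeGen.exists_liftRes_eq`).

If `U` also has a right adjoint then the functor `T = U L` is a left adjoint, and as `E` is a
separator, a morphism out of `T M` is determined by its values on the elements `a x` with `a ∈ A` and
`x ∈ M` (`FreeGen.free_hom_ext`). This takes the place of the Eilenberg-Watts isomorphism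
`T M ≅ A ⊗ M`: it shows that algebras over the monad `T` are the same as `A`-modules, so `K` is an
equivalence as soon as `U` is monadic (`FreeGen.isEquivalence_lift`).

For `E = R ⊗ Rᵒᵖ` and `U` monoidal, `P` is a comonoid in `C` with comultiplication `1 ↦ 1 ⊗ 1` and
counit `1 ↦ 1` (`FreeGen.comonGen`), and its image under `U` is the comonoid `A`. By naturality of
the structure maps of `U`, the action of `a` on `U (X ⊗ Y)` corresponds to the action of `Δ a` on
`U X ⊗ U Y` (`FreeGen.act_comul`). This identity gives the axioms of a bialgebroid that involve `Δ`
and makes the structure isomorphisms of `U` linear over `A`, so that `K` is monoidal.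

Conversely, restriction of scalars along a ring homomorphism has both adjoints, hence is monadic by
the reflexive form of Beck's theorem, and monadicity survives precomposition with an equivalence
(`nonempty_monadicRightAdjoint_comp`).
-/

noncomputable section

/-! ### Extension of scalars along a homomorphism of noncommutative rings -/

namespace RingExtension

variable {E A : Type u} [Ring E] [Ring A] (f : E →+* A)

/-- The relations imposed on the free `A`-module on the elements of `M` that make the canonical
map from `M` additive and `E`-linear. -/
def inducedRel (M : ModuleCat.{u} E) : Submodule A (M →₀ A) :=
  Submodule.span A
    ({z | ∃ m m' : M, z = Finsupp.single (m + m') 1 - Finsupp.single m 1 - Finsupp.single m' 1} ∪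
      {z | ∃ (e : E) (m : M), z = Finsupp.single (e • m) 1 - Finsupp.single m (f e)})

/-- The `A`-module induced from the `E`-module `M`, presented by generators and relations. -/
def induced (M : ModuleCat.{u} E) : ModuleCat.{u} A :=
  ModuleCat.of A ((M →₀ A) ⧸ inducedRel f M)

/-- The canonical `E`-linear map from a module to the induced module. -/
def toInduced (M : ModuleCat.{u} E) : M ⟶ (ModuleCat.restrictScalars f).obj (induced f M) :=
  ModuleCat.ofHom (Y := (ModuleCat.restrictScalars f).obj (induced f M))
    { toFun := fun m => (inducedRel f M).mkQ (Finsupp.single m 1)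
      map_add' := fun m m' => by
        refine Eq.trans ?_ (map_add (inducedRel f M).mkQ _ _)
        refine (Submodule.Quotient.eq _).2 ?_
        rw [← sub_sub]
        exact Submodule.subset_span (Or.inl ⟨m, m', rfl⟩)
      map_smul' := fun e m => by
        refine Eq.trans ?_ (map_smul (inducedRel f M).mkQ (f e) (Finsupp.single m 1))
        refine (Submodule.Quotient.eq _).2 ?_
        rw [Finsupp.smul_single, smul_eq_mul, mul_one]
        exact Submodule.subset_span (Or.inr ⟨e, m, rfl⟩) }

variable {f} in
/-- The map out of the induced module given by an additive map that is linear along `f`. -/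
def inducedDesc {M : ModuleCat.{u} E} {N : ModuleCat.{u} A} (g : M → N)
    (h₁ : ∀ m m', g (m + m') = g m + g m') (h₂ : ∀ (e : E) m, g (e • m) = f e • g m) :
    induced f M ⟶ N :=
  ModuleCat.ofHom ((inducedRel f M).liftQ
    (Finsupp.lsum ℕ fun m : M => LinearMap.toSpanSingleton A N (g m)) (by
      refine Submodule.span_le.2 ?_
      rintro _ (⟨m, m', rfl⟩ | ⟨e, m, rfl⟩)
      · refine LinearMap.mem_ker.2 ?_
        rw [map_sub, map_sub, Finsupp.lsum_single, Finsupp.lsum_single, Finsupp.lsum_single,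
          LinearMap.toSpanSingleton_apply_one, LinearMap.toSpanSingleton_apply_one,
          LinearMap.toSpanSingleton_apply_one, sub_sub, sub_eq_zero, h₁]
      · refine LinearMap.mem_ker.2 ?_
        rw [map_sub, Finsupp.lsum_single, Finsupp.lsum_single,
          LinearMap.toSpanSingleton_apply_one, LinearMap.toSpanSingleton_apply, sub_eq_zero, h₂]))

lemma inducedDesc_mk {M : ModuleCat.{u} E} {N : ModuleCat.{u} A} (g : M → N) (h₁)
    (h₂ : ∀ (e : E) m, g (e • m) = f e • g m) (m : M) :
    (inducedDesc g h₁ h₂).hom ((inducedRel f M).mkQ (Finsupp.single m 1)) = g m := by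
  refine (Submodule.liftQ_apply _ _ _).trans ?_
  rw [Finsupp.lsum_single, LinearMap.toSpanSingleton_apply_one]

/-- The map out of the induced module that extends an `E`-linear map. -/
def inducedLift {M : ModuleCat.{u} E} {N : ModuleCat.{u} A}
    (g : M ⟶ (ModuleCat.restrictScalars f).obj N) : induced f M ⟶ N :=
  inducedDesc (fun m => g.hom m) (g.hom.map_add) (g.hom.map_smul)

lemma toInduced_inducedLift {M : ModuleCat.{u} E} {N : ModuleCat.{u} A}
    (g : M ⟶ (ModuleCat.restrictScalars f).obj N) :
    toInduced f M ≫ (ModuleCat.restrictScalars f).map (inducedLift f g) = g := by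
  ext m
  exact inducedDesc_mk (f := f) (fun m => g.hom m) g.hom.map_add g.hom.map_smul m

lemma induced_hom_ext {M : ModuleCat.{u} E} {N : ModuleCat.{u} A} {g g' : induced f M ⟶ N}
    (h : toInduced f M ≫ (ModuleCat.restrictScalars f).map g =
      toInduced f M ≫ (ModuleCat.restrictScalars f).map g') : g = g' := by
  refine ModuleCat.hom_ext (Submodule.linearMap_qext _ (Finsupp.lhom_ext' fun m => ?_))
  refine LinearMap.ext_ring ?_
  exact congrArg (fun φ => φ.hom m) h

/-- Restriction of scalars along a ring homomorphism has a left adjoint. -/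
instance isRightAdjoint_restrictScalars :
    (ModuleCat.restrictScalars.{u} f).IsRightAdjoint :=
  (Adjunction.adjunctionOfEquivLeft (G := ModuleCat.restrictScalars.{u} f) (F_obj := induced f)
    (fun M N =>
      { toFun := fun g => toInduced f M ≫ (ModuleCat.restrictScalars f).map g
        invFun := inducedLift f
        left_inv := fun _ => induced_hom_ext f (toInduced_inducedLift f _)
        right_inv := toInduced_inducedLift f })
    (fun M N N' g h => by simp)).isRightAdjoint

end RingExtension

/-! ### Monadicity of the forgetful functor of a bialgebroid -/

/-- Precomposing a monadic functor with an equivalence of categories gives a monadic functor. -/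
lemma nonempty_monadicRightAdjoint_comp {B : Type*} [Category* B] {C : Type*} [Category* C]
    {D : Type*} [Category* D] (e : C ≌ D) (G : D ⥤ B) [MonadicRightAdjoint G] :
    Nonempty (MonadicRightAdjoint (e.functor ⋙ G)) := by
  let L := monadicLeftAdjoint G
  let adj : L ⊣ G := monadicAdjunction G
  let adj' : L ⋙ e.inverse ⊣ e.functor ⋙ G := adj.comp e.symm.toAdjunction
  have hunit (M) : adj'.unit.app M = adj.unit.app M ≫ G.map (e.counitInv.app (L.obj M)) := by
    simp [adj', L]
  have hcounit (X) : e.functor.map (adj'.counit.app X) =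
      e.counit.app (L.obj (G.obj (e.functor.obj X))) ≫ adj.counit.app (e.functor.obj X) := by
    simp [adj', L]
  -- The two adjunctions induce isomorphic monads, and the comparison functors correspond.
  let t : (L ⋙ e.inverse) ⋙ e.functor ⋙ G ≅ L ⋙ G :=
    NatIso.ofComponents (fun M => G.mapIso (e.counitIso.app (L.obj M)))
      (fun f => by simp [← Functor.map_comp])
  let i : adj'.toMonad ≅ adj.toMonad := MonadIso.mk t
    (fun M => by
      change adj'.unit.app M ≫ G.map (e.counit.app (L.obj M)) = adj.unit.app M
      rw [hunit, Category.assoc, ← Functor.map_comp, Iso.inv_hom_id_app]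
      simp)
    (fun M => by
      change G.map (e.functor.map (adj'.counit.app (e.inverse.obj (L.obj M)))) ≫
          G.map (e.counit.app (L.obj M)) =
        (G.map (e.functor.map (e.inverse.map (L.map (G.map (e.counit.app (L.obj M)))))) ≫
          G.map (e.counit.app (L.obj (G.obj (L.obj M))))) ≫ G.map (adj.counit.app (L.obj M))
      rw [hcounit]
      simp only [← Functor.map_comp, Category.assoc]
      congr 1
      have h₁ := e.counit.naturality (L.map (G.map (e.counit.app (L.obj M))))
      have h₂ := adj.counit.naturality (e.counit.app (L.obj M))
      exact ((congrArg (e.counit.app _ ≫ ·) h₂.symm).trans (Category.assoc _ _ _).symm).trans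
        ((congrArg (· ≫ adj.counit.app (L.obj M)) h₁.symm).trans (Category.assoc _ _ _)))
  let c : e.functor ⋙ Monad.comparison adj ⋙ Monad.algebraFunctorOfMonadHom i.hom ≅
      Monad.comparison adj' :=
    NatIso.ofComponents (fun X => Monad.Algebra.isoMk (Iso.refl _) (by
      change G.map (e.functor.map (e.inverse.map (L.map (𝟙 _)))) ≫
        G.map (e.functor.map (adj'.counit.app X)) =
          (G.map (e.counit.app (L.obj (G.obj (e.functor.obj X)))) ≫
            G.map (adj.counit.app (e.functor.obj X))) ≫ 𝟙 _
      rw [hcounit]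
      simp)) (fun f => by
        ext
        exact (Category.comp_id _).trans (Category.id_comp _).symm)
  have : (Monad.comparison adj).IsEquivalence := MonadicRightAdjoint.eqv
  have : (Monad.algebraFunctorOfMonadHom i.hom).IsEquivalence :=
    (Monad.algebraEquivOfIsoMonads i.symm).isEquivalence_functor
  exact ⟨⟨_, adj', Functor.isEquivalence_of_iso c⟩⟩

section

variable {k : Type w} [CommRing k] {R : Type u} [Ring R] [Algebra k R]
  {C : Type u₁} [Category.{v₁} C]

lemma nonempty_monadicRightAdjoint_comp_forget (A : Bialgebroid k R) (K : C ⥤ A.Mod)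
    [K.IsEquivalence] : Nonempty (MonadicRightAdjoint (K ⋙ A.forget)) := by
  have : (ModuleCat.restrictScalars.{u} (A.st : EnvAlg k R →+* A.carrier)).IsLeftAdjoint :=
    (ModuleCat.restrictCoextendScalarsAdj _).isLeftAdjoint
  have : Monad.PreservesColimitOfIsReflexivePair A.forget := ⟨fun _ _ _ =>
    have := (Adjunction.ofIsLeftAdjoint A.forget).leftAdjoint_preservesColimits.{0, 0}
    inferInstance⟩
  let _ : MonadicRightAdjoint A.forget :=
    Monad.monadicOfHasPreservesReflexiveCoequalizersOfReflectsIsomorphisms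
      (Adjunction.ofIsRightAdjoint A.forget)
  exact nonempty_monadicRightAdjoint_comp K.asEquivalence A.forget

lemma isLeftAdjoint_comp_forget (A : Bialgebroid k R) (K : C ⥤ A.Mod)
    [K.IsEquivalence] : (K ⋙ A.forget).IsLeftAdjoint :=
  have : (ModuleCat.restrictScalars.{u} (A.st : EnvAlg k R →+* A.carrier)).IsLeftAdjoint :=
    (ModuleCat.restrictCoextendScalarsAdj _).isLeftAdjoint
  inferInstance

end

/-! ### The algebra represented by the free object on one generator -/

namespace FreeGen

variable {E : Type u} [Ring E] {C : Type u₁} [Category.{v₁} C] {U : C ⥤ ModuleCat.{u} E}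
  {L : ModuleCat.{u} E ⥤ C} (adj : L ⊣ U)

/-- The map `e ↦ e x` from the regular module. -/
def span {M : ModuleCat.{u} E} (x : M) : ModuleCat.of E E ⟶ M :=
  ModuleCat.ofHom (LinearMap.toSpanSingleton E M x)

lemma span_comp {M N : ModuleCat.{u} E} (x : M) (f : M ⟶ N) : span x ≫ f = span (f.hom x) := by
  ext
  simp [span]

lemma reg_hom_ext {M : ModuleCat.{u} E} {f g : ModuleCat.of E E ⟶ M}
    (h : f.hom (1 : E) = g.hom (1 : E)) : f = g :=
  ModuleCat.hom_ext (LinearMap.ext_ring h)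

/-- The free object on one generator. -/
abbrev gen (_ : L ⊣ U) : C := L.obj (ModuleCat.of E E)

/-- The insertion of generators, on elements. -/
def ins {M : ModuleCat.{u} E} (x : M) : U.obj (L.obj M) := (adj.unit.app M).hom x

/-- The generator of the free object on one generator. -/
def pt : U.obj (gen adj) := ins adj (M := ModuleCat.of E E) (1 : E)

/-- The morphism from the free object that sends the generator to `x`. -/
def desc {X : C} (x : U.obj X) : gen adj ⟶ X := L.map (span x) ≫ adj.counit.app X

lemma map_ins {M N : ModuleCat.{u} E} (f : M ⟶ N) (x : M) :
    (U.map (L.map f)).hom (ins adj x) = ins adj (f.hom x) :=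
  (congrArg (fun g => g.hom x) (adj.unit.naturality f)).symm

lemma counit_ins {X : C} (x : U.obj X) : (U.map (adj.counit.app X)).hom (ins adj x) = x :=
  congrArg (fun g => g.hom x) (adj.right_triangle_components X)

@[simp] lemma desc_pt {X : C} (x : U.obj X) : (U.map (desc adj x)).hom (pt adj) = x := by
  rw [desc, U.map_comp, ModuleCat.comp_apply, pt, map_ins]
  refine (congrArg (fun y => (U.map (adj.counit.app X)).hom (ins adj y)) ?_).trans
    (counit_ins adj x)
  exact one_smul E x

lemma gen_hom_ext {X : C} {f g : gen adj ⟶ X}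
    (h : (U.map f).hom (pt adj) = (U.map g).hom (pt adj)) : f = g :=
  (adj.homEquiv _ _).injective (reg_hom_ext (by
    rw [adj.homEquiv_unit, adj.homEquiv_unit]; exact h))

lemma desc_eq {X : C} {x : U.obj X} {f : gen adj ⟶ X} (h : (U.map f).hom (pt adj) = x) :
    desc adj x = f :=
  gen_hom_ext adj ((desc_pt adj x).trans h.symm)

/-- The elements of `U P`, for `P` the free object on one generator, act on `U X` for every `X`:
`a x` is the image of `a` under the morphism `P ⟶ X` that corresponds to `x`. -/
def act {X : C} (a : U.obj (gen adj)) (x : U.obj X) : U.obj X := (U.map (desc adj x)).hom a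

lemma map_act {X Y : C} (f : X ⟶ Y) (a : U.obj (gen adj)) (x : U.obj X) :
    (U.map f).hom (act adj a x) = act adj a ((U.map f).hom x) := by
  have : desc adj ((U.map f).hom x) = desc adj x ≫ f := desc_eq adj (by simp)
  rw [act, act, this, U.map_comp, ModuleCat.comp_apply]

lemma pt_act {X : C} (x : U.obj X) : act adj (pt adj) x = x := desc_pt adj x

lemma act_pt (a : U.obj (gen adj)) : act adj a (pt adj) = a := by
  rw [act, desc_eq adj (f := 𝟙 _) (by simp)]
  simp

lemma act_act {X : C} (a b : U.obj (gen adj)) (x : U.obj X) :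
    act adj (act adj a b) x = act adj a (act adj b x) :=
  map_act adj (desc adj x) a b

lemma smul_act {X : C} (e : E) (a : U.obj (gen adj)) (x : U.obj X) :
    act adj (e • a) x = e • act adj a x := map_smul _ _ _

lemma add_act {X : C} (a b : U.obj (gen adj)) (x : U.obj X) :
    act adj (a + b) x = act adj a x + act adj b x := map_add _ _ _

lemma zero_act {X : C} (x : U.obj X) : act adj 0 x = 0 := map_zero _

section Algebra

variable [Preadditive C]

/-- Linearity of `U` over `k` makes the image of `k` central in the algebra of `U`. -/
lemma act_algebraMap_smul {k : Type w} [CommRing k] [Algebra k E] [Linear k C] [U.Linear k] (c : k)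
    {X : C} (a : U.obj (gen adj)) (x : U.obj X) :
    act adj a (algebraMap k E c • x) = algebraMap k E c • act adj a x := by
  rw [act, desc_eq adj (f := c • desc adj x) (by
    rw [U.map_smul]
    exact congrArg (algebraMap k E c • ·) (desc_pt adj x)), U.map_smul]
  rfl

variable [U.Additive]

lemma act_add {X : C} (a : U.obj (gen adj)) (x y : U.obj X) :
    act adj a (x + y) = act adj a x + act adj a y := by
  rw [act, desc_eq adj (f := desc adj x + desc adj y) (by rw [U.map_add]; simp), U.map_add]
  rfl

lemma act_zero {X : C} (a : U.obj (gen adj)) : act adj a (0 : U.obj X) = 0 := by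
  rw [act, desc_eq adj (f := 0) (by rw [U.map_zero]; rfl), U.map_zero]
  rfl

/-- The algebra of the elements of `U P`, where `P` is the free object on one generator; it is the
opposite of the endomorphism ring of `P`. -/
def Alg (adj : L ⊣ U) : Type u := U.obj (gen adj)

instance : AddCommGroup (Alg adj) := inferInstanceAs (AddCommGroup (U.obj (gen adj)))

instance : Ring (Alg adj) :=
  { (inferInstance : AddCommGroup (Alg adj)) with
    mul := fun a b => act adj (X := gen adj) a b
    one := pt adj
    left_distrib := act_add adj (X := gen adj)
    right_distrib := add_act adj (X := gen adj)
    zero_mul := zero_act adj (X := gen adj)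
    mul_zero := act_zero adj (X := gen adj)
    mul_assoc := act_act adj (X := gen adj)
    one_mul := pt_act adj (X := gen adj)
    mul_one := act_pt adj }

/-- The ring homomorphism that sends `e` to its product with the generator. -/
def structHom : E →+* Alg adj where
  toFun e := (e • pt adj : U.obj (gen adj))
  map_one' := one_smul E (pt adj)
  map_mul' e e' := (mul_smul e e' (pt adj)).trans
    ((congrArg (e • ·) (pt_act adj (e' • pt adj)).symm).trans (smul_act adj _ _ _).symm)
  map_zero' := zero_smul E (pt adj)
  map_add' e e' := add_smul e e' (pt adj)

lemma structHom_act (e : E) {X : C} (x : U.obj X) :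
    act adj (structHom adj e : U.obj (gen adj)) x = e • x :=
  (smul_act adj e _ x).trans (congrArg (e • ·) (pt_act adj x))

/-- The action of the algebra on the values of `U`. -/
@[reducible] def actModule (X : C) : Module (Alg adj) (U.obj X) where
  smul a x := act adj (X := X) a x
  one_smul := pt_act adj
  mul_smul := act_act adj
  smul_zero := act_zero adj
  smul_add := act_add adj
  add_smul := add_act adj
  zero_smul := zero_act adj

/-- The lift of `U` to modules over the algebra. -/
def lift : C ⥤ ModuleCat.{u} (Alg adj) where
  obj X := letI := actModule adj X; ModuleCat.of (Alg adj) (U.obj X)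
  map {X Y} f :=
    letI := actModule adj X
    letI := actModule adj Y
    ModuleCat.ofHom
      { toFun := fun x => (U.map f).hom x
        map_add' := map_add (U.map f).hom
        map_smul' := fun a x => map_act adj f a x }
  map_id X := by ext x; exact congrArg (fun g => g.hom x) (U.map_id X)
  map_comp f g := by ext x; exact congrArg (fun g => g.hom x) (U.map_comp f g)

/-- The lift of `U` followed by restriction of scalars is `U`, by the identity maps. -/
def liftRes : lift adj ⋙ ModuleCat.restrictScalars (structHom adj) ≅ U :=
  NatIso.ofComponents (fun X =>
    { hom := ModuleCat.ofHom (X := (lift adj ⋙ ModuleCat.restrictScalars (structHom adj)).obj X)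
        (Y := U.obj X)
        { toFun := fun x => x, map_add' := fun _ _ => rfl,
          map_smul' := fun e x => structHom_act adj e x }
      inv := ModuleCat.ofHom (X := U.obj X)
        (Y := (lift adj ⋙ ModuleCat.restrictScalars (structHom adj)).obj X)
        { toFun := fun x => x, map_add' := fun _ _ => rfl,
          map_smul' := fun e x => (structHom_act adj e x).symm }
      hom_inv_id := rfl
      inv_hom_id := rfl }) (fun _ => rfl)

/-- Two equal module structures define equal objects, and the morphism between them that comes from
this equality is the identity map. -/
lemma exists_eqToHom_eq {M : ModuleCat.{u} E} (m : Module E M) (f : @ModuleCat.of E _ M _ m ⟶ M)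
    (hm : m = M.isModule) (hf : ∀ x : M, f.hom x = x) :
    ∃ h : @ModuleCat.of E _ M _ m = M, eqToHom h = f := by
  subst hm
  exact ⟨rfl, by ext x; exact (hf x).symm⟩

/-- A natural isomorphism all of whose components come from equalities of objects comes from an
equality of functors. -/
lemma exists_functor_eq {B D : Type*} [Category* B] [Category* D] {F G : B ⥤ D} (t : F ≅ G)
    (ht : ∀ X, ∃ h : F.obj X = G.obj X, eqToHom h = t.hom.app X) :
    ∃ h : F = G, eqToHom h = t.hom := by
  choose h ht using ht
  have key : F = G := CategoryTheory.Functor.ext h (fun X Y f => by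
    rw [← Category.assoc, ← comp_eqToHom_iff (h Y), ht, ht, t.hom.naturality])
  refine ⟨key, NatTrans.ext (funext fun X => ?_)⟩
  rw [eqToHom_app, ht]

/-- The lift of `U` followed by restriction of scalars is strictly equal to `U`. -/
lemma exists_liftRes_eq :
    ∃ h : lift adj ⋙ ModuleCat.restrictScalars (structHom adj) = U,
      eqToHom h = (liftRes adj).hom := by
  have key (X : C) : ∃ h : (lift adj ⋙ ModuleCat.restrictScalars (structHom adj)).obj X = U.obj X,
      eqToHom h = (liftRes adj).hom.app X :=
    exists_eqToHom_eq (M := U.obj X)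
      ((lift adj ⋙ ModuleCat.restrictScalars (structHom adj)).obj X).isModule
      ((liftRes adj).hom.app X)
      (Module.ext (funext₂ fun e x => structHom_act adj e x))
      (fun _ => rfl)
  exact exists_functor_eq _ key

instance : (lift adj).Additive where
  map_add {X Y f g} := by
    ext x
    exact congrArg (fun h => h.hom x) (U.map_add (f := f) (g := g))

variable {k : Type w} [CommRing k] [Algebra k E] [Linear k C] [U.Linear k]

instance : Algebra k (Alg adj) :=
  ((structHom adj).comp (algebraMap k E)).toAlgebra' (fun c a =>
    (structHom_act adj (algebraMap k E c) (X := gen adj) a).trans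
      ((congrArg (algebraMap k E c • ·) (act_pt adj a).symm).trans
        (act_algebraMap_smul adj c a (pt adj)).symm))

variable (k) in
/-- The structure homomorphism as a homomorphism of `k`-algebras. -/
def structAlgHom : E →ₐ[k] Alg adj :=
  { structHom adj with commutes' := fun _ => rfl }

instance : (lift adj).Linear k where
  map_smul {X Y} f c := by
    ext x
    refine (congrArg (fun h => h.hom x) (U.map_smul c f)).trans ?_
    exact (structHom_act adj (algebraMap k E c) ((U.map f).hom x)).symm

end Algebra

/-! ### The lift is an equivalence if the functor is monadic and has a right adjoint -/

lemma map_span {M : ModuleCat.{u} E} (x : M) : L.map (span x) = desc adj (ins adj x) :=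
  (desc_eq adj (by rw [pt, map_ins]; exact congrArg (ins adj) (one_smul E x))).symm

lemma ins_reg (e : E) : ins adj (M := ModuleCat.of E E) e = e • pt adj :=
  (congrArg (ins adj (M := ModuleCat.of E E)) (mul_one e).symm).trans
    (map_smul (adj.unit.app (ModuleCat.of E E)).hom e (1 : E))

lemma map_act_ins {M M' : ModuleCat.{u} E} (f : M ⟶ M') (a : U.obj (gen adj)) (x : M) :
    (U.map (L.map f)).hom (act adj a (ins adj x)) = act adj a (ins adj (f.hom x)) := by
  rw [map_act, map_ins]

lemma counit_act_ins {X : C} (a : U.obj (gen adj)) (x : U.obj X) :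
    (U.map (adj.counit.app X)).hom (act adj a (ins adj x)) = act adj a x := by
  rw [map_act, counit_ins]

section Modules

variable [Preadditive C] [U.Additive]

/-- The underlying `E`-module of a module over the algebra. -/
abbrev under (N : ModuleCat.{u} (Alg adj)) : ModuleCat.{u} E :=
  (ModuleCat.restrictScalars (structHom adj)).obj N

/-- The map `a ↦ a x` for an element `x` of a module over the algebra. -/
def orbit {N : ModuleCat.{u} (Alg adj)} (x : N) : U.obj (gen adj) ⟶ under adj N :=
  ModuleCat.ofHom (X := U.obj (gen adj)) (Y := under adj N)
    { toFun := fun a => ((show Alg adj from a) • x : N)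
      map_add' := fun a b => add_smul (R := Alg adj) _ _ x
      map_smul' := fun e a => by
        have h : (show Alg adj from e • a) = structHom adj e * (show Alg adj from a) :=
          (structHom_act adj e a).symm
        exact (congrArg (· • x) h).trans (mul_smul (structHom adj e) _ x) }

lemma orbit_add {N : ModuleCat.{u} (Alg adj)} (x y : N) :
    orbit adj (x + y) = orbit adj x + orbit adj y := by
  ext a
  exact smul_add (A := N) (show Alg adj from a) x y

lemma orbit_smul {N : ModuleCat.{u} (Alg adj)} (e : E) (x : N) :
    orbit adj (structHom adj e • x) = U.map (L.map (span (M := ModuleCat.of E E) e)) ≫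
      orbit adj x := by
  ext a
  have h : (U.map (L.map (span (M := ModuleCat.of E E) e))).hom a = act adj a (e • pt adj) := by
    rw [map_span, ins_reg, act]
  refine Eq.trans ?_ (congrArg (orbit adj x).hom h).symm
  exact (mul_smul (show Alg adj from a) (structHom adj e) x).symm

end Modules

section RightAdjoint

variable [U.IsLeftAdjoint]

/-- The composite `M ↦ U (L M)` as a left adjoint functor. -/
def adjT : L ⋙ U ⊣ Functor.rightAdjoint U ⋙ U := adj.comp (Adjunction.ofIsLeftAdjoint U)

/-- If the set `S` generates `M` then the elements `a x`, for `x` in `S` and `a` in the algebra,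
generate `U (L M)`: this is where the right adjoint of `U` is used. -/
lemma free_hom_ext {M : ModuleCat.{u} E} {S : Set M}
    (hS : ∀ {Q : ModuleCat.{u} E} {f g : M ⟶ Q}, (∀ x ∈ S, f.hom x = g.hom x) → f = g)
    {Q : ModuleCat.{u} E} {f g : U.obj (L.obj M) ⟶ Q}
    (h : ∀ x ∈ S, ∀ a : U.obj (gen adj),
      f.hom (act adj a (ins adj x)) = g.hom (act adj a (ins adj x))) : f = g := by
  refine ((adjT adj).homEquiv M Q).injective (hS fun x hx => ?_)
  have h₁ : span x ≫ (adjT adj).homEquiv M Q f = span x ≫ (adjT adj).homEquiv M Q g := by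
    rw [← Adjunction.homEquiv_naturality_left, ← Adjunction.homEquiv_naturality_left]
    congr 1
    ext a
    have := h x hx a
    rwa [act, ← map_span] at this
  rw [span_comp, span_comp] at h₁
  have h₂ := congrArg (fun φ => φ.hom (1 : E)) h₁
  exact (one_smul E _).symm.trans (h₂.trans (one_smul E _))

/-- The case of `free_hom_ext` in which all elements of `M` are taken as generators. -/
lemma free_hom_ext' {M : ModuleCat.{u} E} {Q : ModuleCat.{u} E} {f g : U.obj (L.obj M) ⟶ Q}
    (h : ∀ (x : M) (a : U.obj (gen adj)),
      f.hom (act adj a (ins adj x)) = g.hom (act adj a (ins adj x))) : f = g :=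
  free_hom_ext adj (S := Set.univ)
    (fun h => ModuleCat.hom_ext (LinearMap.ext fun x => h x trivial)) (fun x _ => h x)

/-- A morphism out of `U (L (U (L M)))` is determined by its values on the elements `b (a x)`, with
`x` in `M`. -/
lemma free_free_hom_ext {M : ModuleCat.{u} E} {Q : ModuleCat.{u} E}
    {f g : U.obj (L.obj (U.obj (L.obj M))) ⟶ Q}
    (h : ∀ (x : M) (a b : U.obj (gen adj)),
      f.hom (act adj b (ins adj (act adj a (ins adj x)))) =
        g.hom (act adj b (ins adj (act adj a (ins adj x))))) : f = g :=
  free_hom_ext adj (S := {y | ∃ a x, y = act adj a (ins adj x)})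
    (fun h => free_hom_ext' adj fun x a => h _ ⟨a, x, rfl⟩)
    (by rintro _ ⟨a, x, rfl⟩ b; exact h x a b)

variable [Preadditive C] [U.Additive]

/-- The structure map `U (L N) ⟶ N` that makes a module `N` over the algebra an algebra over the
monad of the adjunction: it extends the identity of `N` linearly over the algebra. As the functor
`M ↦ U (L M)` is a left adjoint, the map is obtained as the transpose of an `E`-linear map out of
`N`. -/
lemma exists_structure (N : ModuleCat.{u} (Alg adj)) :
    ∃ h : U.obj (L.obj (under adj N)) ⟶ under adj N, ∀ (a : U.obj (gen adj)) (x : under adj N),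
      h.hom (act adj a (ins adj x)) = (orbit adj (N := N) x).hom a := by
  let H := (adjT adj).homEquiv (ModuleCat.of E E) (under adj N)
  have : (Functor.rightAdjoint U).Additive :=
    Adjunction.right_adjoint_additive (Adjunction.ofIsLeftAdjoint U)
  have hadd (f g) : H (f + g) = H f + H g := by
    simp only [H, Adjunction.homEquiv_unit, Functor.map_add, Preadditive.comp_add]
  -- The transpose sends `x` to the transpose, evaluated at `1`, of the map `a ↦ a x`.
  let φ : under adj N ⟶ (Functor.rightAdjoint U ⋙ U).obj (under adj N) :=
    ModuleCat.ofHom (X := under adj N)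
      { toFun := fun x => (H (orbit adj (N := N) x)).hom (1 : E)
        map_add' := fun x y => congrArg (fun f => f.hom (1 : E))
          ((congrArg H (orbit_add adj (N := N) x y)).trans (hadd _ _))
        map_smul' := fun e x => by
          refine (congrArg (fun f => (H f).hom (1 : E)) (orbit_smul adj (N := N) e x)).trans ?_
          refine (congrArg (fun f => f.hom (1 : E))
            (Adjunction.homEquiv_naturality_left (adjT adj) (span (M := ModuleCat.of E E) e)
              (orbit adj (N := N) x))).trans ?_
          refine Eq.trans ?_ (map_smul (H (orbit adj (N := N) x)).hom e (1 : E))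
          exact congrArg (H (orbit adj (N := N) x)).hom
            ((one_mul e).trans (mul_one e).symm) }
  refine ⟨((adjT adj).homEquiv _ _).symm φ, fun a x => ?_⟩
  have h : span x ≫ φ = H (orbit adj (N := N) x) := by
    rw [span_comp]
    exact reg_hom_ext (one_smul E (φ.hom x))
  have h' : (L ⋙ U).map (span x) ≫ ((adjT adj).homEquiv _ _).symm φ = orbit adj (N := N) x := by
    rw [← Adjunction.homEquiv_naturality_left_symm, h, Equiv.symm_apply_apply]
  refine Eq.trans ?_ (congrArg (fun f => f.hom a) h')
  rw [act, ← map_span]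
  rfl

/-- If `U` is monadic and has a right adjoint then its lift to modules over the algebra is an
equivalence of categories. -/
lemma isEquivalence_lift [(Monad.comparison adj).IsEquivalence] : (lift adj).IsEquivalence where
  faithful := ⟨fun {X Y f g} h => (Monad.comparison adj).map_injective (by
    ext x
    exact congrArg (fun f => f.hom x) h)⟩
  full := ⟨fun {X Y} g => by
    let g' : U.obj X ⟶ U.obj Y :=
      (liftRes adj).inv.app X ≫ (ModuleCat.restrictScalars _).map g ≫ (liftRes adj).hom.app Y
    have hg (a : U.obj (gen adj)) (x : U.obj X) : g'.hom (act adj a x) = act adj a (g'.hom x) :=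
      g.hom.map_smul (show Alg adj from a) x
    -- A map that commutes with the action of the algebra is a morphism of algebras over the monad.
    let γ : (Monad.comparison adj).obj X ⟶ (Monad.comparison adj).obj Y :=
      { f := g'
        h := free_hom_ext' adj fun x a => by
          refine (congrArg (U.map (adj.counit.app Y)).hom (map_act_ins adj g' a x)).trans ?_
          refine (counit_act_ins adj a _).trans ?_
          refine (hg a x).symm.trans ?_
          exact congrArg g'.hom (counit_act_ins adj a x).symm }
    refine ⟨(Monad.comparison adj).preimage γ, ?_⟩
    ext x
    exact congrArg (fun f => f.f.hom x) ((Monad.comparison adj).map_preimage γ)⟩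
  essSurj := ⟨fun N => by
    obtain ⟨h, hh⟩ := exists_structure adj N
    have hact (a b : U.obj (gen adj)) (x : under adj N) :
        (orbit adj (N := N) x).hom (act adj a b) =
          (orbit adj (N := N) ((orbit adj (N := N) x).hom b)).hom a :=
      mul_smul (show Alg adj from a) (show Alg adj from b) (show N from x)
    let B : adj.toMonad.Algebra :=
      { A := under adj N
        a := h
        unit := by
          ext x
          change h.hom (ins adj x) = x
          rw [← pt_act adj (ins adj x), hh]
          exact one_smul (Alg adj) (show N from x)
        assoc := free_free_hom_ext adj fun x a b => by
          change h.hom ((U.map (adj.counit.app _)).hom _) = h.hom ((U.map (L.map h)).hom _)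
          rw [counit_act_ins, map_act_ins, hh, ← act_act, hh, hh, hact] }
    obtain ⟨X, ⟨i⟩⟩ := Functor.EssSurj.mem_essImage (F := Monad.comparison adj) B
    have hi (a : U.obj (gen adj)) (x : U.obj X) : i.hom.f.hom (act adj a x) =
        (orbit adj (N := N) (i.hom.f.hom x)).hom a := by
      refine (congrArg i.hom.f.hom (counit_act_ins adj a x)).symm.trans ?_
      refine (congrArg (fun f => f.hom (act adj a (ins adj x))) i.hom.h).symm.trans ?_
      exact (congrArg h.hom (map_act_ins adj i.hom.f a x)).trans (hh a _)
    let j : U.obj X ≅ under adj N := (Monad.forget _).mapIso i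
    let l : (lift adj).obj X ≃ₗ[Alg adj] N :=
      { j.toLinearEquiv.toAddEquiv with
        map_smul' := hi }
    exact ⟨X, ⟨l.toModuleIso⟩⟩⟩

end RightAdjoint

end FreeGen

/-! ### The bialgebroid of a monoidal functor -/

namespace FreeGen

open Takeuchi BimodCat Functor.LaxMonoidal Functor.OplaxMonoidal

variable {k : Type w} [CommRing k] {R : Type u} [Ring R] [Algebra k R]
  {C : Type u₁} [Category.{v₁} C] [Preadditive C] [Linear k C]
  {U : C ⥤ BimodCat k R} [U.Additive] [U.Linear k] {L : BimodCat k R ⥤ C} (adj : L ⊣ U)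

/-- The functor `U`, with the bimodule structure on its values that comes from the action of the
algebra. -/
abbrev viaAlg : C ⥤ BimodCat k R := lift adj ⋙ res (structAlgHom adj k)

/-- The morphism from the free object on one generator that sends the generator to `x`. -/
def extend {X : C} (x : (viaAlg adj).obj X) : gen adj ⟶ X := desc adj x

/-- The generator, as an element of the regular module of the algebra. -/
def one : (viaAlg adj).obj (gen adj) := pt adj

lemma map_extend {X : C} (x : (viaAlg adj).obj X) :
    (viaAlg adj).map (extend adj x) = spanHom ((lift adj).obj X) x := rfl

lemma extend_hom_ext {X : C} {f g : gen adj ⟶ X}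
    (h : ((viaAlg adj).map f).hom (one adj) = ((viaAlg adj).map g).hom (one adj)) : f = g :=
  gen_hom_ext adj h

lemma map_extend_one {X : C} (x : (viaAlg adj).obj X) :
    ((viaAlg adj).map (extend adj x)).hom (one adj) = x :=
  desc_pt adj x

/-- The scalar multiplication by elements of the algebra, on the bimodules `viaAlg`. -/
def sm {X : C} (a : Alg adj) (x : (viaAlg adj).obj X) : (viaAlg adj).obj X :=
  a • (show (lift adj).obj X from x)

lemma map_sm {X Y : C} (f : X ⟶ Y) (a : Alg adj) (x : (viaAlg adj).obj X) :
    ((viaAlg adj).map f).hom (sm adj a x) = sm adj a (((viaAlg adj).map f).hom x) :=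
  map_act adj f a x

lemma one_sm {X : C} (x : (viaAlg adj).obj X) : sm adj 1 x = x :=
  one_smul (Alg adj) (show (lift adj).obj X from x)

lemma mul_sm {X : C} (a b : Alg adj) (x : (viaAlg adj).obj X) :
    sm adj (a * b) x = sm adj a (sm adj b x) :=
  mul_smul a b (show (lift adj).obj X from x)

lemma viaAlg_map_comp {X Y Z : C} (f : X ⟶ Y) (g : Y ⟶ Z) (x : (viaAlg adj).obj X) :
    ((viaAlg adj).map (f ≫ g)).hom x = ((viaAlg adj).map g).hom (((viaAlg adj).map f).hom x) := by
  rw [Functor.map_comp]; rfl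

lemma viaAlg_map_id {X : C} (x : (viaAlg adj).obj X) : ((viaAlg adj).map (𝟙 X)).hom x = x := by
  rw [CategoryTheory.Functor.map_id]; rfl

lemma smul_one_eq (e : EnvAlg k R) :
    e • one adj = toReg (structAlgHom adj k) (structAlgHom adj k e) :=
  mul_one (structAlgHom adj k e)

lemma spanHom_one_eq : spanHom (η := structAlgHom adj k) ((lift adj).obj (gen adj)) (one adj) =
    𝟙 (reg (structAlgHom adj k)) := spanHom_one

lemma rmulHom_eq (e : EnvAlg k R) : rmulHom (structAlgHom adj k) (structAlgHom adj k e) =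
    spanHom ((lift adj).obj (gen adj)) (e • one adj) :=
  congrArg (spanHom (η := structAlgHom adj k) (ModuleCat.of (Alg adj) (Alg adj)))
    (smul_one_eq adj e).symm

variable [MonoidalCategory C] [(viaAlg adj).Monoidal]

/-- The image of a pure tensor under the monoidal structure of `U`. -/
def mtm {X Y : C} (x : (viaAlg adj).obj X) (y : (viaAlg adj).obj Y) : (viaAlg adj).obj (X ⊗ Y) :=
  (μ (viaAlg adj) X Y).hom (tm x y)

lemma map_mtm {X X' Y Y' : C} (f : X ⟶ X') (g : Y ⟶ Y') (x : (viaAlg adj).obj X)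
    (y : (viaAlg adj).obj Y) : ((viaAlg adj).map (f ⊗ₘ g)).hom (mtm adj x y) =
      mtm adj (((viaAlg adj).map f).hom x) (((viaAlg adj).map g).hom y) :=
  (congrArg (fun φ => φ.hom (tm x y)) (μ_natural (viaAlg adj) f g)).symm

lemma map_assoc_mtm {X Y Z : C} (x : (viaAlg adj).obj X) (y : (viaAlg adj).obj Y)
    (z : (viaAlg adj).obj Z) : ((viaAlg adj).map (α_ X Y Z).hom).hom (mtm adj (mtm adj x y) z) =
      mtm adj x (mtm adj y z) :=
  congrArg (fun φ => φ.hom (tm (tm x y) z)) (Functor.LaxMonoidal.associativity (viaAlg adj) X Y Z)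

/-- The image of an element of `R` under the monoidal structure of `U`. -/
def munit (r : R) : (viaAlg adj).obj (𝟙_ C) := (ε (viaAlg adj)).hom (toUnit r)

lemma map_leftUnitor_mtm {X : C} (x : (viaAlg adj).obj X) :
    ((viaAlg adj).map (λ_ X).hom).hom (mtm adj (munit adj 1) x) = x :=
  (congrArg (fun φ => φ.hom (tm (toUnit 1) x))
    (Functor.LaxMonoidal.left_unitality (viaAlg adj) X)).symm.trans
    (one_smul (EnvAlg k R) x)

lemma map_rightUnitor_mtm {X : C} (x : (viaAlg adj).obj X) :
    ((viaAlg adj).map (ρ_ X).hom).hom (mtm adj x (munit adj 1)) = x :=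
  (congrArg (fun φ => φ.hom (tm x (toUnit 1)))
    (Functor.LaxMonoidal.right_unitality (viaAlg adj) X)).symm.trans
    (one_smul (EnvAlg k R) x)

lemma map_whiskerRight_mtm {X X' Y : C} (f : X ⟶ X') (x : (viaAlg adj).obj X)
    (y : (viaAlg adj).obj Y) : ((viaAlg adj).map (f ▷ Y)).hom (mtm adj x y) =
      mtm adj (((viaAlg adj).map f).hom x) y := by
  rw [← tensorHom_id, map_mtm, viaAlg_map_id]

lemma map_whiskerLeft_mtm {X Y Y' : C} (g : Y ⟶ Y') (x : (viaAlg adj).obj X)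
    (y : (viaAlg adj).obj Y) : ((viaAlg adj).map (X ◁ g)).hom (mtm adj x y) =
      mtm adj x (((viaAlg adj).map g).hom y) := by
  rw [← id_tensorHom, map_mtm, viaAlg_map_id]

/-- The free object on one generator `1` is a comonoid with comultiplication `1 ↦ 1 ⊗ 1`. -/
instance comonGen : ComonObj (gen adj) where
  comul := extend adj (mtm adj (one adj) (one adj))
  counit := extend adj (munit adj 1)
  counit_comul := by
    rw [← cancel_mono (λ_ _).hom, Iso.inv_hom_id]
    refine extend_hom_ext adj ?_
    rw [viaAlg_map_comp, viaAlg_map_comp, map_extend_one, map_whiskerRight_mtm, map_extend_one,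
      map_leftUnitor_mtm, viaAlg_map_id]
  comul_counit := by
    rw [← cancel_mono (ρ_ _).hom, Iso.inv_hom_id]
    refine extend_hom_ext adj ?_
    rw [viaAlg_map_comp, viaAlg_map_comp, map_extend_one, map_whiskerLeft_mtm, map_extend_one,
      map_rightUnitor_mtm, viaAlg_map_id]
  comul_assoc := by
    refine extend_hom_ext adj ?_
    rw [viaAlg_map_comp, viaAlg_map_comp, viaAlg_map_comp, map_extend_one, map_whiskerLeft_mtm,
      map_whiskerRight_mtm, map_extend_one, map_assoc_mtm]

/-- The image of the comonoid `P` under `U`; the underlying bimodule of `U P` is that of the regular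
module of the algebra. -/
instance comonReg : ComonObj (reg (structAlgHom adj k)) :=
  Functor.obj.instComonObj (gen adj) (viaAlg adj)

/-- The comultiplication is determined by `1 ↦ 1 ⊗ 1`. -/
lemma comul_apply (a : Alg adj) :
    (ComonObj.comul (X := reg (structAlgHom adj k))).hom (toReg (structAlgHom adj k) a) =
      (δ (viaAlg adj) (gen adj) (gen adj)).hom (sm adj a (mtm adj (one adj) (one adj))) :=
  rfl

lemma counit_apply (a : Alg adj) :
    (ComonObj.counit (X := reg (structAlgHom adj k))).hom (toReg (structAlgHom adj k) a) =
      (η (viaAlg adj)).hom (sm adj a (munit adj 1)) :=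
  rfl

lemma δ_mtm {X Y : C} (x : (viaAlg adj).obj X) (y : (viaAlg adj).obj Y) :
    (δ (viaAlg adj) X Y).hom (mtm adj x y) = tm x y :=
  congrArg (fun φ => φ.hom (tm x y)) (Functor.Monoidal.μ_δ (viaAlg adj) X Y)

lemma η_munit (r : R) : (η (viaAlg adj)).hom (munit adj r) = toUnit r :=
  congrArg (fun φ => φ.hom (toUnit r)) (Functor.Monoidal.ε_η (viaAlg adj))

lemma munit_η (x : (viaAlg adj).obj (𝟙_ C)) :
    munit adj (ofUnit ((η (viaAlg adj)).hom x)) = x :=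
  congrArg (fun φ => φ.hom x) (Functor.Monoidal.η_ε (viaAlg adj))

lemma μ_δ_apply {X Y : C} (x : (viaAlg adj).obj (X ⊗ Y)) :
    (μ (viaAlg adj) X Y).hom ((δ (viaAlg adj) X Y).hom x) = x :=
  congrArg (fun φ => φ.hom x) (Functor.Monoidal.δ_μ (viaAlg adj) X Y)

/-- The comultiplication describes the action of `a` on the image of a pure tensor. -/
lemma map_span_comul {X Y : C} (a : Alg adj) (x : (viaAlg adj).obj X) (y : (viaAlg adj).obj Y) :
    (map (spanHom ((lift adj).obj X) x) (spanHom ((lift adj).obj Y) y)).hom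
      ((ComonObj.comul (X := reg (structAlgHom adj k))).hom (toReg (structAlgHom adj k) a)) =
        (δ (viaAlg adj) X Y).hom (sm adj a (mtm adj x y)) := by
  rw [comul_apply, ← map_extend, ← map_extend]
  refine (congrArg (fun φ => φ.hom (sm adj a (mtm adj (one adj) (one adj))))
    (δ_natural (viaAlg adj) (extend adj x) (extend adj y))).trans ?_
  change (δ (viaAlg adj) X Y).hom (((viaAlg adj).map (extend adj x ⊗ₘ extend adj y)).hom _) = _
  rw [map_sm, map_mtm, map_extend_one, map_extend_one]

lemma mtm_balanced {X Y : C} (r : R) (x : (viaAlg adj).obj X) (y : (viaAlg adj).obj Y) :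
    mtm adj (envR k r • x) y = mtm adj x (envL k r • y) :=
  congrArg (μ (viaAlg adj) X Y).hom (tm_balanced r x y)

/-- The comultiplication takes values in the Takeuchi product because the structure maps of `U` are
balanced over `R`. -/
lemma comul_mem (a : Alg adj) :
    (ComonObj.comul (X := reg (structAlgHom adj k))).hom (toReg (structAlgHom adj k) a) ∈
      takeuchi (structAlgHom adj k) := by
  intro r
  have h₁ := map_span_comul adj a (envR k r • one adj) (one adj)
  have h₂ := map_span_comul adj a (one adj) (envL k r • one adj)
  rw [spanHom_one_eq, ← rmulHom_eq] at h₁ h₂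
  exact h₁.trans ((congrArg (fun x => (δ (viaAlg adj) _ _).hom (sm adj a x))
    (mtm_balanced adj r (one adj) (one adj))).trans h₂.symm)

/-- The action of `Δ a` on a tensor product of values of `U` corresponds to the action of `a`. -/
lemma act_comul {X Y : C} (a : Alg adj)
    (z : tensor ((viaAlg adj).obj X) ((viaAlg adj).obj Y)) :
    Takeuchi.act ((lift adj).obj X) ((lift adj).obj Y) ⟨_, comul_mem adj a⟩ z =
      (δ (viaAlg adj) X Y).hom (sm adj a ((μ (viaAlg adj) X Y).hom z)) := by
  induction z using tensor_induction with
  | zero =>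
    rw [map_zero, map_zero]
    exact ((congrArg (δ (viaAlg adj) X Y).hom
      (smul_zero (A := (lift adj).obj (X ⊗ Y)) a)).trans (map_zero _)).symm
  | tm x y => exact map_span_comul adj a x y
  | add x y hx hy =>
    rw [map_add, map_add, hx, hy, ← map_add]
    exact congrArg (δ (viaAlg adj) X Y).hom
      (smul_add (A := (lift adj).obj (X ⊗ Y)) a _ _).symm

/-- The action of `a` on `r ∈ R` is that of `a s(r)` on `1`, as `r = s(r) 1`. -/
lemma sm_munit (a : Alg adj) (r : R) :
    sm adj a (munit adj r) = sm adj (a * src (structAlgHom adj k) r) (munit adj 1) := by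
  rw [mul_sm]
  refine congrArg (sm adj a) ?_
  refine Eq.trans ?_ (map_smul (ε (viaAlg adj)).hom (envL k r) (toUnit 1))
  rw [envL_smul_unit, ofUnit_toUnit, mul_one]
  rfl

/-- The action of `a` on `r ∈ R` is that of `a t(r)` on `1`, as `r = t(r) 1`. -/
lemma sm_munit' (a : Alg adj) (r : R) :
    sm adj a (munit adj r) = sm adj (a * tgt (structAlgHom adj k) r) (munit adj 1) := by
  rw [mul_sm]
  refine congrArg (sm adj a) ?_
  refine Eq.trans ?_ (map_smul (ε (viaAlg adj)).hom (envR k r) (toUnit 1))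
  rw [envR_smul_unit, ofUnit_toUnit, one_mul]
  rfl

/-- The bialgebroid of the monoidal functor `U`: its axioms are the compatibility of the action of the
algebra with the structure maps of `U`. -/
def bialgebroid : Bialgebroid k R where
  carrier := Alg adj
  st := structAlgHom adj k
  comul_mem := comul_mem adj
  comul_one := by
    rw [comul_apply, one_sm, δ_mtm]
    rfl
  comul_mul a b := by
    refine Eq.trans ?_ (act_comul adj a _).symm
    rw [comul_apply, mul_sm]
    exact congrArg (fun x => (δ (viaAlg adj) _ _).hom (sm adj a x)) (μ_δ_apply adj _).symm
  counit_one := by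
    rw [counit_apply, one_sm, η_munit]
    rfl
  counit_mul_tgt a b := by
    rw [counit_apply, counit_apply, counit_apply, ← sm_munit', munit_η, mul_sm]
  counit_mul_src a b := by
    rw [counit_apply, counit_apply, counit_apply, ← sm_munit, munit_η, mul_sm]

/-- The lift of `U` to modules over the bialgebroid. -/
abbrev toMod : C ⥤ (bialgebroid adj).Mod := lift adj

/-- The monoidal structure of `U`, as a family of `A`-linear isomorphisms. -/
def μLift (X Y : C) : (toMod adj).obj X ⊗ (toMod adj).obj Y ≅ (toMod adj).obj (X ⊗ Y) :=
  (bialgebroid adj).liftIso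
    (((bialgebroid adj).forgetTensor _ _).symm ≪≫ Functor.Monoidal.μIso (viaAlg adj) X Y)
    (fun a z => by
      refine (congrArg (μ (viaAlg adj) X Y).hom (act_comul adj a z)).trans ?_
      exact μ_δ_apply adj _)

/-- The unit constraint of `U`, as an `A`-linear isomorphism. -/
def εLift : 𝟙_ (bialgebroid adj).Mod ≅ (toMod adj).obj (𝟙_ C) :=
  (bialgebroid adj).liftIso
    ((bialgebroid adj).forgetUnit.symm ≪≫ Functor.Monoidal.εIso (viaAlg adj))
    (fun a r => by
      refine (munit_η adj _).trans ?_
      exact (sm_munit adj a (ofUnit r)).symm)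

end FreeGen

/-! ### The monoidal structure of the lift -/

section

open Functor.LaxMonoidal Functor.OplaxMonoidal Functor.Monoidal

/-- A functor `K` is monoidal if its composite with a faithful monoidal functor `G` is monoidal and
the structure isomorphisms of the composite come from isomorphisms in the source of `G`. -/
@[reducible] def coreMonoidalOfComp {B D E : Type*} [Category* B] [Category* D] [Category* E]
    [MonoidalCategory B] [MonoidalCategory D] [MonoidalCategory E] (K : B ⥤ D) (G : D ⥤ E)
    [G.Faithful] [G.Monoidal] [(K ⋙ G).Monoidal]
    (e : 𝟙_ D ≅ K.obj (𝟙_ B)) (m : ∀ X Y : B, K.obj X ⊗ K.obj Y ≅ K.obj (X ⊗ Y))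
    (he : G.map e.hom = η G ≫ ε (K ⋙ G))
    (hm : ∀ X Y, G.map (m X Y).hom = δ G (K.obj X) (K.obj Y) ≫ μ (K ⋙ G) X Y) :
    K.CoreMonoidal where
  εIso := e
  μIso := m
  μIso_hom_natural_left f X' := G.map_injective (by
    have h := μ_natural_left (K ⋙ G) f X'
    simp only [Functor.comp_obj, Functor.comp_map] at h
    simp only [Functor.map_comp, hm, map_whiskerRight, Category.assoc, μ_δ_assoc, h])
  μIso_hom_natural_right X' f := G.map_injective (by
    have h := μ_natural_right (K ⋙ G) X' f
    simp only [Functor.comp_obj, Functor.comp_map] at h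
    simp only [Functor.map_comp, hm, map_whiskerLeft, Category.assoc, μ_δ_assoc, h])
  associativity X Y Z := G.map_injective (by
    have h := Functor.LaxMonoidal.associativity (K ⋙ G) X Y Z
    simp only [Functor.comp_obj, Functor.comp_map] at h
    simp only [Functor.map_comp, hm, map_whiskerLeft, map_whiskerRight, map_associator,
      Category.assoc, μ_δ_assoc, MonoidalCategory.comp_whiskerRight,
      MonoidalCategory.whiskerLeft_comp, whiskerLeft_μ_δ_assoc, h])
  left_unitality X := G.map_injective (by
    have h := Functor.LaxMonoidal.left_unitality (K ⋙ G) X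
    simp only [Functor.comp_obj, Functor.comp_map] at h
    simp [he, hm, map_whiskerRight, map_leftUnitor, h])
  right_unitality X := G.map_injective (by
    have h := Functor.LaxMonoidal.right_unitality (K ⋙ G) X
    simp only [Functor.comp_obj, Functor.comp_map] at h
    simp [he, hm, map_whiskerLeft, map_rightUnitor, h])

end

namespace FreeGen

open Takeuchi BimodCat Functor.LaxMonoidal Functor.OplaxMonoidal

variable {k : Type w} [CommRing k] {R : Type u} [Ring R] [Algebra k R]
  {C : Type u₁} [Category.{v₁} C] [Preadditive C] [Linear k C]
  {U : C ⥤ BimodCat k R} [U.Additive] [U.Linear k] {L : BimodCat k R ⥤ C} (adj : L ⊣ U)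
variable [MonoidalCategory C] [(viaAlg adj).Monoidal]

/-- The monoidal structure of the lift of `U`; its structure maps are those of `U`. -/
instance toModMonoidal : (toMod adj).Monoidal :=
  letI : (toMod adj ⋙ (bialgebroid adj).forget).Monoidal := inferInstanceAs (viaAlg adj).Monoidal
  (coreMonoidalOfComp (toMod adj) (bialgebroid adj).forget (εLift adj) (μLift adj)
    rfl (fun _ _ => rfl)).toMonoidal

lemma ε_toMod_comp_forget :
    ε (toMod adj ⋙ (bialgebroid adj).forget) = ε (viaAlg adj) :=
  (Iso.hom_inv_id_assoc (bialgebroid adj).forgetUnit (ε (viaAlg adj)) :)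

lemma μ_toMod_comp_forget (X Y : C) :
    μ (toMod adj ⋙ (bialgebroid adj).forget) X Y = μ (viaAlg adj) X Y :=
  (Iso.hom_inv_id_assoc ((bialgebroid adj).forgetTensor ((toMod adj).obj X) ((toMod adj).obj Y))
    (μ (viaAlg adj) X Y) :)

end FreeGen

/-! ### The representation theorem -/

/-- A monadic monoidal functor with a right adjoint is, as a monoidal functor, the forgetful functor
of a bialgebroid. -/
theorem exists_bialgebroid {k : Type w} [CommRing k] {R : Type u} [Ring R] [Algebra k R]
    {C : Type u₁} [Category.{v₁} C] [Preadditive C] [Linear k C] [MonoidalCategory C]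
    (U : C ⥤ BimodCat k R) [U.Additive] [U.Linear k] [hU : U.Monoidal]
    [MonadicRightAdjoint U] [U.IsLeftAdjoint] :
    ∃ (A : Bialgebroid k R) (K : C ⥤ A.Mod) (_ : K.Monoidal) (h : K ⋙ A.forget = U),
      K.Additive ∧ K.Linear k ∧ K.IsEquivalence ∧ NatTrans.IsMonoidal (eqToHom h) := by
  let adj := monadicAdjunction U
  let t : U ≅ FreeGen.viaAlg adj := (FreeGen.liftRes adj).symm
  let _ : (FreeGen.viaAlg adj).Monoidal := Functor.Monoidal.transport t
  -- The equality of functors is realized by identity maps, so its monoidality is that of `t`.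
  obtain ⟨h, ht⟩ : ∃ h : FreeGen.toMod adj ⋙ (FreeGen.bialgebroid adj).forget = U,
      eqToHom h = (FreeGen.liftRes adj).hom := FreeGen.exists_liftRes_eq adj
  refine ⟨FreeGen.bialgebroid adj, FreeGen.toMod adj, inferInstance, h,
    inferInstanceAs (FreeGen.lift adj).Additive, inferInstanceAs ((FreeGen.lift adj).Linear k),
    FreeGen.isEquivalence_lift adj, ?_⟩
  rw [ht]
  have : NatTrans.IsMonoidal t.hom := Functor.Monoidal.natTransIsMonoidal_of_transport t
  have ht' : NatTrans.IsMonoidal t.inv := inferInstance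
  exact
    { unit := (congrArg (· ≫ t.inv.app (𝟙_ C)) (FreeGen.ε_toMod_comp_forget adj)).trans ht'.unit
      tensor := fun X Y => (congrArg (· ≫ t.inv.app (X ⊗ Y))
        (FreeGen.μ_toMod_comp_forget adj X Y)).trans (ht'.tensor X Y) }

end

/-- The representation theorem for bialgebroids. -/
theorem mainTheorem12 (k : Type w) [CommRing k] (R : Type u) [Ring R] [Algebra k R]
    (C : Type u₁) [Category.{v₁} C] [Preadditive C] [Linear k C] [MonoidalCategory C]
    [MonoidalPreadditive C] [MonoidalLinear k C]
    (U : C ⥤ BimodCat k R) [U.Additive] [U.Linear k] :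
    ((∃ (A : Bialgebroid k R) (K : C ⥤ A.Mod),
        K.Additive ∧ K.Linear k ∧ Nonempty K.Monoidal ∧ K.IsEquivalence ∧ K ⋙ A.forget = U) ↔
      (Nonempty (MonadicRightAdjoint U) ∧ Nonempty U.Monoidal ∧ U.IsLeftAdjoint)) ∧
    (∀ _ : U.Monoidal, Nonempty (MonadicRightAdjoint U) → U.IsLeftAdjoint →
      ∃ (A : Bialgebroid k R) (K : C ⥤ A.Mod) (_ : K.Monoidal) (h : K ⋙ A.forget = U),
        K.Additive ∧ K.Linear k ∧ K.IsEquivalence ∧ NatTrans.IsMonoidal (eqToHom h)) := by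
  refine ⟨⟨?_, ?_⟩, ?_⟩
  · rintro ⟨A, K, -, -, ⟨_⟩, _, rfl⟩
    exact ⟨nonempty_monadicRightAdjoint_comp_forget A K, ⟨inferInstance⟩,
      isLeftAdjoint_comp_forget A K⟩
  · rintro ⟨⟨_⟩, ⟨_⟩, _⟩
    obtain ⟨A, K, hK, h, hadd, hlin, heq, -⟩ := exists_bialgebroid U
    exact ⟨A, K, hadd, hlin, ⟨hK⟩, heq, h⟩
  · rintro _ ⟨_⟩ _
    exact exists_bialgebroid U
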